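/- **CLT for the Gibbs average.** Let $G_n=(V_n,E_n)$, $n\ge 1$, be finite simple graphs, and for each $n$ let $\mathcal S_n$ be a finite collection of spanning subgraphs of $G_n$, each identified with its edge set $\pi\subseteq E_n$. Call $\Gamma\subseteq E_n$ a *partial matching* if its edges are pairwise vertex disjoint, and write $\mathbb P_\pi$ for the probability when $\pi$ is chosen uniformly at random from $\mathcal S_n$. Assume the following, where conditions on individual $n$ are only required for all sufficiently large $n$. *I.* $G_n$ is edge-transitive, $|V_n|=c\,n$ for a fixed integer $c\ge 1$, and $|E_n|=\Theta(|V_n|^2)$. *II.* The weights $(\omega_e)_{e\in E_n}$ are i.i.d. with a common law that does not depend on $n$, take values in $(-\infty,+\infty]$, are not almost surely equal to $+\infty$, and satisfy $\psi(b):=\log\mathbb E e^{-b\omega}<\infty$ for all $b\in(0,\infty)$ (with $e^{-\infty}=0$). *III.1.* All $\pi\in\mathcal S_n$ have the same number $m=m_n$ of edges, and $\lim_{n\to\infty} m^2/(2|E_n|)=\gamma\in(0,\infty)$. *III.2.* Every partial matching $\Gamma\subseteq E_n$ is contained in some $\pi\in\mathcal S_n$. *III.3.* There is a constant $\rho\in(0,\infty)$,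 independent of $n$, such that every partial matching $\Gamma\subseteq E_n$ satisfies $$\left|\frac{\mathbb P_\pi(\Gamma\subseteq\pi)}{\prod_{e\in\Gamma}\mathbb P_\pi(e\in\pi)}-1\right|\le\frac{\rho^{|\Gamma|}}{\sqrt m}.$$ *III.4.* There is a constant $\rho\in(0,\infty)$, independent of $n$, such that every $\Gamma\subseteq E_n$ that is contained in some element of $\mathcal S_n$ and is not a partial matching satisfies $\mathbb P_\pi(\Gamma\subseteq\pi)\le\rho^{|\Gamma|}\prod_{e\in\Gamma}\mathbb P_\pi(e\in\pi)$. Assume also that $\mathbb P_\pi(e\in\pi)$ is the same for all $e\in E_n$, hence equal to $m/|E_n|$ (by edge-transitivity this holds whenever $\mathcal S_n$ is invariant under the automorphisms of $G_n$). Let $W(\pi)=\sum_{e\in\pi}\omega_e$, and for $\beta>0$ let $\langle\cdot\rangle_\beta$ be the expectation with respect to the Gibbs measure $$\mathbb P_{\beta,\omega}(\pi)=\frac{1}{Z(\beta)}\cdot\frac{1}{|\mathcal S_n|}e^{-\beta W(\pi)},\qquad Z(\beta)=\frac{1}{|\mathcal S_n|}\sum_{\pi\in\mathcal S_n}e^{-\beta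 W(\pi)},$$ for fixed weights $\omega$. Configurations with $W(\pi)=+\infty$ contribute $0$ to $\langle W(\pi)\rangle_\beta$, and $\langle W(\pi)\rangle_\beta:=0$ if all configurations have infinite weight. Then for every fixed $\beta\in(0,\infty)$, as $n\to\infty$, the random variable $\langle W(\pi)\rangle_\beta+m\,\psi'(\beta)$ converges weakly to the normal law with mean $$2\gamma\,\bigl(\psi'(2\beta)-\psi'(\beta)\bigr)\,e^{\psi(2\beta)-2\psi(\beta)}$$ and variance $$2\gamma\,\bigl((\psi'(\beta)-\psi'(2\beta))^2+\psi''(2\beta)\bigr)\,e^{\psi(2\beta)-2\psi(\beta)}$$ (the point mass at the mean if the variance is zero). -/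

import Mathlib

open MeasureTheory ProbabilityTheory Filter Topology Asymptotics
open scoped ENNReal

namespace GibbsCLT

/-- A graph is edge-transitive if any edge is mapped to any other edge by some automorphism. -/
def IsEdgeTransitive {V : Type*} (G : SimpleGraph V) : Prop :=
  ∀ e ∈ G.edgeSet, ∀ f ∈ G.edgeSet, ∃ φ : G ≃g G, Sym2.map φ e = f

/-- A finite set of edges is a partial matching if its edges are pairwise vertex disjoint. -/
def IsPartialMatching {V : Type*} {G : SimpleGraph V} (Γ : Finset G.edgeSet) : Prop :=
  ∀ e ∈ Γ, ∀ f ∈ Γ, e ≠ f → ∀ v : V, ¬ (v ∈ (e : Sym2 V) ∧ v ∈ (f : Sym2 V))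

open scoped Classical in
/-- `ℙ(Γ ⊆ π)` for `π` chosen uniformly at random from the finite family `S` of edge sets. -/
noncomputable def containProb {α : Type*} (S : Finset (Finset α)) (Γ : Finset α) : ℝ :=
  ((S.filter fun π => Γ ⊆ π).card : ℝ) / (S.card : ℝ)

/-- `e^{-βx}` for an extended real `x` (for `β > 0`, this is `0` at `x = +∞` and `∞` at
`x = -∞`). -/
noncomputable def expNeg (β : ℝ) (x : EReal) : ℝ≥0∞ :=
  EReal.exp (-((β : EReal) * x))

/-- `𝔼 e^{-βω}` for a weight `ω` with law `μ`. -/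
noncomputable def laplace (μ : Measure EReal) (β : ℝ) : ℝ≥0∞ :=
  ∫⁻ x, expNeg β x ∂μ

/-- `ψ(β) = log 𝔼 e^{-βω}` for a weight `ω` with law `μ`. -/
noncomputable def psi (μ : Measure EReal) (β : ℝ) : ℝ :=
  Real.log (laplace μ β).toReal

/-- The total weight `W(π) = ∑_{e ∈ π} w_e`. -/
noncomputable def weight {α : Type*} (w : α → EReal) (π : Finset α) : EReal :=
  ∑ e ∈ π, w e

/-- The partition function `Z(β) = |S|⁻¹ ∑_{π ∈ S} e^{-βW(π)}`. -/
noncomputable def partitionFunction {α : Type*} (S : Finset (Finset α)) (w : α → EReal)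
    (β : ℝ) : ℝ :=
  (1 / (S.card : ℝ)) * ∑ π ∈ S, (expNeg β (weight w π)).toReal

/-- The Gibbs probability `Z(β)⁻¹ |S|⁻¹ e^{-βW(π)}` of the configuration `π`. It vanishes when
`W(π) = +∞`; it is read as `0` for every `π` on the exceptional event `Z(β) = 0`, on which all
configurations have infinite weight. -/
noncomputable def gibbsProb {α : Type*} (S : Finset (Finset α)) (w : α → EReal)
    (β : ℝ) (π : Finset α) : ℝ :=
  (1 / partitionFunction S w β) * (1 / (S.card : ℝ)) * (expNeg β (weight w π)).toReal

/-- The Gibbs average `⟨W(π)⟩_β`. Configurations of infinite weight have Gibbs probability `0` and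
do not contribute. -/
noncomputable def gibbsAverage {α : Type*} (S : Finset (Finset α)) (w : α → EReal)
    (β : ℝ) : ℝ :=
  ∑ π ∈ S, gibbsProb S w β π * (weight w π).toReal

/-- The mean `2γ (ψ'(2β) - ψ'(β)) e^{ψ(2β) - 2ψ(β)}` of the limiting normal law. -/
noncomputable def limitMean (μ : Measure EReal) (γ β : ℝ) : ℝ :=
  2 * γ * (deriv (psi μ) (2 * β) - deriv (psi μ) β) *
    Real.exp (psi μ (2 * β) - 2 * psi μ β)

/-- The variance `2γ ((ψ'(β) - ψ'(2β))² + ψ''(2β)) e^{ψ(2β) - 2ψ(β)}` of the limiting normal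
law. -/
noncomputable def limitVar (μ : Measure EReal) (γ β : ℝ) : ℝ :=
  2 * γ * ((deriv (psi μ) β - deriv (psi μ) (2 * β)) ^ 2 + deriv (deriv (psi μ)) (2 * β)) *
    Real.exp (psi μ (2 * β) - 2 * psi μ β)

end GibbsCLT

/-! Write L = 𝔼 e^{-βω}, p = m/|E_n|, X_e = e^{-βω_e}/L - 1 and Y_e = ∂X_e/∂β. Since every π has m
edges, Z(β)/L^m is the average over π of ∏_{e∈π} (1 + X_e), that is, the cluster sum ∑_Δ ℙ(Δ ⊆ π)
∏_{e∈Δ} X_e. Its logarithmic derivative in β is -(⟨W⟩ + m ψ'(β)), a quotient of two cluster sums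
(`gibbsAverage_add_eq`). This identity is proved algebraically, with `prodDeriv` standing for the
Leibniz rule.

The X_e and Y_e are centred and independent over e, so the monomials of different Δ are orthogonal
in L², with second moments at most C^|Δ|. Replacing ℙ(Δ ⊆ π) by p^|Δ| therefore changes a cluster
sum by at most ∑_Δ (ℙ(Δ ⊆ π) - p^|Δ|)² C^|Δ| in squared L² norm. This tends to 0
(`tendsto_sum_sq_containProb_sub`): matchings gain a factor 1/m, and any other Δ contains one of at
most |V|³ adjacent edge pairs, at a cost of order |V|³ p⁴ = O(1/|V|).

After the replacement the denominator is ∏ (1 + pX_e) and the quotient is ∑ pY_e/(1 + pX_e) = p ∑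
Y_e - p² ∑ X_e Y_e + O(p³ ∑ |X_e² Y_e|). As |E_n| p² → 2γ, the first term is asymptotically N(0, 2γ
𝔼Y²), the second sum tends to 2γ 𝔼[XY], and the remainder vanishes. The inverse of ∏ (1 + pX_e) is
bounded in probability, so the quotients stay close as well (`negligible_div_sub_div`,
`negligible_cluster_quotient_sub`). -/

namespace GibbsCLT

/-! ### Exponential monomials on the extended reals. -/

/-- The function `x ↦ x^j e^{-bx}` on extended reals, vanishing at `+∞`. -/
noncomputable def expMoment (b : ℝ) (j : ℕ) (x : EReal) : ℝ :=
  x.toReal ^ j * (expNeg b x).toReal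

lemma expNeg_top {b : ℝ} (hb : 0 < b) : expNeg b ⊤ = 0 := by
  simp [expNeg, EReal.coe_mul_top_of_pos hb]

lemma expNeg_bot {b : ℝ} (hb : 0 < b) : expNeg b ⊥ = ∞ := by
  simp [expNeg, EReal.coe_mul_bot_of_pos hb]

lemma expNeg_coe (b r : ℝ) : expNeg b (r : EReal) = ENNReal.ofReal (Real.exp (-b * r)) := by
  simp only [expNeg]
  rw [← EReal.coe_mul, ← EReal.coe_neg, EReal.exp_coe, neg_mul]

lemma expMoment_top {b : ℝ} (hb : 0 < b) (j : ℕ) : expMoment b j ⊤ = 0 := by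
  simp [expMoment, expNeg_top hb]

lemma expMoment_coe (b : ℝ) (j : ℕ) (r : ℝ) :
    expMoment b j (r : EReal) = r ^ j * Real.exp (-b * r) := by
  simp [expMoment, expNeg_coe, ENNReal.toReal_ofReal (Real.exp_pos _).le]

lemma expMoment_zero_nonneg (b : ℝ) (x : EReal) : 0 ≤ expMoment b 0 x := by
  simp [expMoment]

@[fun_prop]
lemma measurable_expNeg (b : ℝ) : Measurable (expNeg b) := by
  have h : Measurable fun x : EReal => (b : EReal) * x := by
    refine EReal.measurable_of_measurable_real ?_
    have : Measurable fun p : ℝ => ((b * p : ℝ) : EReal) := by fun_prop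
    simpa using this
  exact EReal.measurable_exp.comp h.neg

@[fun_prop]
lemma measurable_expMoment (b : ℝ) (j : ℕ) : Measurable (expMoment b j) := by
  unfold expMoment
  fun_prop

/-- The family is closed under products. Hence second moments at β are first moments at 2β, which is
why ψ(2β) enters the limit. -/
lemma expMoment_mul {b b' : ℝ} (hb : 0 < b) (hb' : 0 < b') (i j : ℕ) {x : EReal} (hx : x ≠ ⊥) :
    expMoment b i x * expMoment b' j x = expMoment (b + b') (i + j) x := by
  induction x with
  | bot => exact absurd rfl hx
  | top => simp [expMoment_top, hb, hb', add_pos hb hb']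
  | coe r =>
    simp only [expMoment_coe]
    rw [show -(b + b') * r = -b * r + -b' * r by ring, Real.exp_add]
    ring

/-- Cutting off the atom at `⊤` leaves a real exponential against the restricted measure, to which
the theory of `mgf` and `cgf` applies. -/
lemma expMoment_eq_indicator {b : ℝ} (hb : 0 < b) (j : ℕ) {x : EReal} (hx : x ≠ ⊥) :
    expMoment b j x =
      Set.indicator {⊤}ᶜ (fun x : EReal => x.toReal ^ j * Real.exp (-b * x.toReal)) x := by
  induction x with
  | bot => exact absurd rfl hx
  | top => simp [expMoment_top hb]
  | coe r => simp [expMoment_coe]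

/-! ### Moments and cumulants of the weight law. -/

section law

variable {μ : Measure EReal}

lemma ae_ne_bot (hψ : ∀ b : ℝ, 0 < b → laplace μ b < ∞) : ∀ᵐ x ∂μ, x ≠ ⊥ := by
  have h := ae_lt_top (measurable_expNeg 1) (hψ 1 one_pos).ne
  filter_upwards [h] with x hx hbot
  simp [hbot, expNeg_bot] at hx

lemma integral_expMoment (hψ : ∀ b : ℝ, 0 < b → laplace μ b < ∞) {b : ℝ} (hb : 0 < b) (j : ℕ) :
    ∫ x, expMoment b j x ∂μ =
      ∫ x, x.toReal ^ j * Real.exp (-b * x.toReal) ∂(μ.restrict {⊤}ᶜ) := by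
  rw [← integral_indicator (measurableSet_singleton _).compl]
  refine integral_congr_ae ?_
  filter_upwards [ae_ne_bot hψ] with x hx using expMoment_eq_indicator hb j hx

lemma integrable_expMoment_iff (hψ : ∀ b : ℝ, 0 < b → laplace μ b < ∞) {b : ℝ} (hb : 0 < b)
    (j : ℕ) : Integrable (expMoment b j) μ ↔
      Integrable (fun x : EReal => x.toReal ^ j * Real.exp (-b * x.toReal))
        (μ.restrict {⊤}ᶜ) := by
  rw [← IntegrableOn, ← integrable_indicator_iff (measurableSet_singleton _).compl]
  refine integrable_congr ?_
  filter_upwards [ae_ne_bot hψ] with x hx using expMoment_eq_indicator hb j hx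

lemma integrable_expMoment_zero (hψ : ∀ b : ℝ, 0 < b → laplace μ b < ∞) {b : ℝ} (hb : 0 < b) :
    Integrable (expMoment b 0) μ := by
  have : expMoment b 0 = fun x => (expNeg b x).toReal := by ext; simp [expMoment]
  rw [this]
  exact integrable_toReal_of_lintegral_ne_top (by fun_prop) (hψ b hb).ne

/-- All negative exponents are integrable and they form an open half-line. Interior points give all
moments and analyticity of the `cgf`. -/
lemma neg_mem_interior_integrableExpSet (hψ : ∀ b : ℝ, 0 < b → laplace μ b < ∞) {b : ℝ}
    (hb : 0 < b) : -b ∈ interior (integrableExpSet EReal.toReal (μ.restrict {⊤}ᶜ)) := by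
  have h : Set.Iio 0 ⊆ integrableExpSet EReal.toReal (μ.restrict {⊤}ᶜ) := fun t ht => by
    have ht' : 0 < -t := by simpa using ht
    have := (integrable_expMoment_iff hψ ht' 0).1 (integrable_expMoment_zero hψ ht')
    simpa [integrableExpSet] using this
  exact interior_maximal h isOpen_Iio (by simpa using hb)

lemma integrable_expMoment (hψ : ∀ b : ℝ, 0 < b → laplace μ b < ∞) {b : ℝ} (hb : 0 < b)
    (j : ℕ) : Integrable (expMoment b j) μ :=
  (integrable_expMoment_iff hψ hb j).2
    (integrable_pow_mul_exp_of_mem_interior_integrableExpSet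
      (neg_mem_interior_integrableExpSet hψ hb) j)

/-- The fourth power is again in the family, at 4b. Fourth moments are what later puts XY in L² and
X²Y in L¹. -/
lemma memLp_expMoment (hψ : ∀ b : ℝ, 0 < b → laplace μ b < ∞) {b : ℝ} (hb : 0 < b)
    (j : ℕ) : MemLp (expMoment b j) 4 μ := by
  rw [← integrable_norm_rpow_iff (by fun_prop) (by norm_num) (by norm_num)]
  refine (integrable_expMoment hψ (b := 4 * b) (by positivity) (j * 4)).congr ?_
  filter_upwards [ae_ne_bot hψ] with x hx
  have h2 := expMoment_mul hb hb j j hx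
  have h4 := expMoment_mul (add_pos hb hb) (add_pos hb hb) (j + j) (j + j) hx
  have e : ‖expMoment b j x‖ ^ (4 : ℝ≥0∞).toReal = expMoment b j x ^ 4 := by
    rw [show (4 : ℝ≥0∞).toReal = (4 : ℕ) by simp, Real.rpow_natCast, Real.norm_eq_abs,
      Even.pow_abs (by decide)]
  rw [e, show (4 : ℝ) * b = b + b + (b + b) by ring, show j * 4 = j + j + (j + j) by ring,
    ← h4, ← h2]
  ring

lemma laplace_toReal (hψ : ∀ b : ℝ, 0 < b → laplace μ b < ∞) {b : ℝ} (hb : 0 < b) :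
    (laplace μ b).toReal = ∫ x, expMoment b 0 x ∂μ := by
  have : expMoment b 0 = fun x => (expNeg b x).toReal := by ext; simp [expMoment]
  rw [this, integral_toReal (by fun_prop) (ae_lt_top (by fun_prop) (hψ b hb).ne)]
  rfl

lemma restrict_ne_zero [IsProbabilityMeasure μ] (hμ : μ {⊤} ≠ 1) : μ.restrict {⊤}ᶜ ≠ 0 := by
  rw [Ne, Measure.restrict_eq_zero, prob_compl_eq_zero_iff (measurableSet_singleton _)]
  exact hμ

lemma psi_eq_cgf (hψ : ∀ b : ℝ, 0 < b → laplace μ b < ∞) {b : ℝ} (hb : 0 < b) :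
    psi μ b = cgf EReal.toReal (μ.restrict {⊤}ᶜ) (-b) := by
  rw [psi, cgf, mgf, laplace_toReal hψ hb, integral_expMoment hψ hb]
  simp

lemma integral_expMoment_zero_pos [IsProbabilityMeasure μ] (hμ : μ {⊤} ≠ 1)
    (hψ : ∀ b : ℝ, 0 < b → laplace μ b < ∞)
    {b : ℝ} (hb : 0 < b) : 0 < ∫ x, expMoment b 0 x ∂μ := by
  have hint := interior_subset (neg_mem_interior_integrableExpSet hψ hb)
  have h := mgf_pos' (restrict_ne_zero hμ) hint
  rw [integral_expMoment hψ hb]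
  simpa [mgf] using h

lemma exp_psi [IsProbabilityMeasure μ] (hμ : μ {⊤} ≠ 1)
    (hψ : ∀ b : ℝ, 0 < b → laplace μ b < ∞)
    {b : ℝ} (hb : 0 < b) : Real.exp (psi μ b) = ∫ x, expMoment b 0 x ∂μ := by
  rw [psi, laplace_toReal hψ hb, Real.exp_log (integral_expMoment_zero_pos hμ hψ hb)]

lemma hasDerivAt_psi (hψ : ∀ b : ℝ, 0 < b → laplace μ b < ∞)
    {b : ℝ} (hb : 0 < b) :
    HasDerivAt (psi μ) (-deriv (cgf EReal.toReal (μ.restrict {⊤}ᶜ)) (-b)) b := by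
  have h := (analyticAt_cgf (neg_mem_interior_integrableExpSet hψ hb)).differentiableAt.hasDerivAt
  have h2 := h.scomp b (hasDerivAt_neg b)
  refine HasDerivAt.congr_of_eventuallyEq (by simpa using h2) ?_
  filter_upwards [lt_mem_nhds hb] with t ht using psi_eq_cgf hψ ht

lemma deriv_psi (hψ : ∀ b : ℝ, 0 < b → laplace μ b < ∞) {b : ℝ} (hb : 0 < b) :
    deriv (psi μ) b = -((∫ x, expMoment b 1 x ∂μ) / ∫ x, expMoment b 0 x ∂μ) := by
  rw [(hasDerivAt_psi hψ hb).deriv, deriv_cgf (neg_mem_interior_integrableExpSet hψ hb),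
    integral_expMoment hψ hb, integral_expMoment hψ hb]
  simp [mgf]

lemma deriv_deriv_psi (hψ : ∀ b : ℝ, 0 < b → laplace μ b < ∞) {b : ℝ} (hb : 0 < b) :
    deriv (deriv (psi μ)) b = (∫ x, expMoment b 2 x ∂μ) / (∫ x, expMoment b 0 x ∂μ) -
      ((∫ x, expMoment b 1 x ∂μ) / ∫ x, expMoment b 0 x ∂μ) ^ 2 := by
  have hint := neg_mem_interior_integrableExpSet hψ hb
  have h := (analyticAt_cgf hint).deriv.differentiableAt.hasDerivAt
  have h2 := (h.scomp b (hasDerivAt_neg b)).neg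
  have h3 : HasDerivAt (deriv (psi μ))
      (deriv (deriv (cgf EReal.toReal (μ.restrict {⊤}ᶜ))) (-b)) b := by
    refine HasDerivAt.congr_of_eventuallyEq (by simpa using h2) ?_
    filter_upwards [lt_mem_nhds hb] with t ht using (hasDerivAt_psi hψ ht).deriv
  rw [h3.deriv]
  have h4 := iteratedDeriv_two_cgf hint
  rw [iteratedDeriv_succ, iteratedDeriv_one] at h4
  rw [h4, deriv_cgf hint, integral_expMoment hψ hb, integral_expMoment hψ hb,
    integral_expMoment hψ hb]
  simp [mgf]

/-! ### The centred site variables X and Y. -/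

/-- The centred weight factor `e^{-βω} / 𝔼 e^{-βω} - 1`. -/
noncomputable def siteX (μ : Measure EReal) (β : ℝ) (x : EReal) : ℝ :=
  expMoment β 0 x / (∫ z, expMoment β 0 z ∂μ) - 1

/-- The derivative `-(ω + ψ'(β)) e^{-βω} / 𝔼 e^{-βω}` of the centred weight factor in `β`. -/
noncomputable def siteY (μ : Measure EReal) (β : ℝ) (x : EReal) : ℝ :=
  -(expMoment β 1 x + deriv (psi μ) β * expMoment β 0 x) / ∫ z, expMoment β 0 z ∂μ

lemma measurable_siteY (β : ℝ) : Measurable (siteY μ β) := by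
  unfold siteY; fun_prop

lemma neg_one_le_siteX (β : ℝ) (x : EReal) : -1 ≤ siteX μ β x := by
  have : 0 ≤ expMoment β 0 x / ∫ z, expMoment β 0 z ∂μ :=
    div_nonneg (expMoment_zero_nonneg _ _) (integral_nonneg fun z => expMoment_zero_nonneg _ _)
  unfold siteX; linarith

lemma memLp_siteX [IsProbabilityMeasure μ] (hψ : ∀ b : ℝ, 0 < b → laplace μ b < ∞)
    {β : ℝ} (hβ : 0 < β) :
    MemLp (siteX μ β) 4 μ := by
  have := ((memLp_expMoment hψ hβ 0).const_mul (∫ z, expMoment β 0 z ∂μ)⁻¹).sub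
    (memLp_const (1 : ℝ))
  refine this.ae_eq (ae_of_all _ fun x => ?_)
  simp [siteX, div_eq_inv_mul]

lemma memLp_siteY (hψ : ∀ b : ℝ, 0 < b → laplace μ b < ∞)
    {β : ℝ} (hβ : 0 < β) :
    MemLp (siteY μ β) 4 μ := by
  have := (((memLp_expMoment hψ hβ 1).add
    ((memLp_expMoment hψ hβ 0).const_mul (deriv (psi μ) β))).const_mul
      (∫ z, expMoment β 0 z ∂μ)⁻¹).neg
  refine this.ae_eq (ae_of_all _ fun x => ?_)
  simp only [siteY, Pi.neg_apply, Pi.add_apply]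
  ring

lemma integral_siteX [IsProbabilityMeasure μ] (hμ : μ {⊤} ≠ 1)
    (hψ : ∀ b : ℝ, 0 < b → laplace μ b < ∞) {β : ℝ} (hβ : 0 < β) :
    ∫ x, siteX μ β x ∂μ = 0 := by
  have hL := integral_expMoment_zero_pos hμ hψ hβ
  unfold siteX
  rw [integral_sub ((integrable_expMoment hψ hβ 0).div_const _) (integrable_const _),
    integral_div, div_self hL.ne']
  simp

lemma integral_siteY [IsProbabilityMeasure μ] (hμ : μ {⊤} ≠ 1)
    (hψ : ∀ b : ℝ, 0 < b → laplace μ b < ∞) {β : ℝ} (hβ : 0 < β) :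
    ∫ x, siteY μ β x ∂μ = 0 := by
  have hL := integral_expMoment_zero_pos hμ hψ hβ
  unfold siteY
  rw [integral_div, integral_neg, integral_add (integrable_expMoment hψ hβ 1)
    ((integrable_expMoment hψ hβ 0).const_mul _), integral_const_mul, deriv_psi hψ hβ]
  field_simp
  ring

/-- Write XY = (X + 1)Y - Y: the last term has mean 0, and X + 1 = e^{-βω}/L moves the first to the
exponent 2β. -/
lemma integral_siteX_mul_siteY [IsProbabilityMeasure μ] (hμ : μ {⊤} ≠ 1)
    (hψ : ∀ b : ℝ, 0 < b → laplace μ b < ∞) {β : ℝ} (hβ : 0 < β) :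
    ∫ x, siteX μ β x * siteY μ β x ∂μ =
    (deriv (psi μ) (2 * β) - deriv (psi μ) β) * Real.exp (psi μ (2 * β) - 2 * psi μ β) := by
  have hL := integral_expMoment_zero_pos hμ hψ hβ
  have hβ2 : 0 < 2 * β := by positivity
  have hL2 := integral_expMoment_zero_pos hμ hψ hβ2
  set L := ∫ x, expMoment β 0 x ∂μ with hLdef
  have h : (fun x => siteX μ β x * siteY μ β x) =ᵐ[μ] fun x =>
      -(L ^ 2)⁻¹ * (expMoment (2 * β) 1 x + deriv (psi μ) β * expMoment (2 * β) 0 x) -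
        siteY μ β x := by
    filter_upwards [ae_ne_bot hψ] with x hx
    rw [two_mul β, ← expMoment_mul hβ hβ 0 1 hx, ← expMoment_mul hβ hβ 0 0 hx]
    simp only [siteX, siteY, ← hLdef]
    field_simp
    ring
  have i1 := integrable_expMoment hψ hβ2 1
  have i0 := (integrable_expMoment hψ hβ2 0).const_mul (deriv (psi μ) β)
  have i10 : Integrable (fun x => -(L ^ 2)⁻¹ *
      (expMoment (2 * β) 1 x + deriv (psi μ) β * expMoment (2 * β) 0 x)) μ :=
    (i1.add i0).const_mul _
  rw [integral_congr_ae h, integral_sub i10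
    ((memLp_siteY hψ hβ).integrable (by norm_num)), integral_siteY hμ hψ hβ, integral_const_mul,
    integral_add i1 i0, integral_const_mul, Real.exp_sub, two_mul (psi μ β), Real.exp_add,
    exp_psi hμ hψ hβ, exp_psi hμ hψ hβ2, deriv_psi hψ hβ2, ← hLdef]
  field_simp
  ring

/-- Y² is (ω + ψ'(β))² e^{-2βω}/L². Under the law tilted by e^{-2βω}, ω has mean -ψ'(2β) and
variance ψ''(2β), whence the squared bias plus variance. -/
lemma integral_siteY_sq [IsProbabilityMeasure μ] (hμ : μ {⊤} ≠ 1)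
    (hψ : ∀ b : ℝ, 0 < b → laplace μ b < ∞) {β : ℝ} (hβ : 0 < β) :
    ∫ x, siteY μ β x ^ 2 ∂μ =
    ((deriv (psi μ) β - deriv (psi μ) (2 * β)) ^ 2 + deriv (deriv (psi μ)) (2 * β)) *
      Real.exp (psi μ (2 * β) - 2 * psi μ β) := by
  have hL := integral_expMoment_zero_pos hμ hψ hβ
  have hβ2 : 0 < 2 * β := by positivity
  have hL2 := integral_expMoment_zero_pos hμ hψ hβ2
  set L := ∫ x, expMoment β 0 x ∂μ with hLdef
  set D := deriv (psi μ) β with hD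
  have h : (fun x => siteY μ β x ^ 2) =ᵐ[μ] fun x =>
      (L ^ 2)⁻¹ * (expMoment (2 * β) 2 x + 2 * D * expMoment (2 * β) 1 x +
        D ^ 2 * expMoment (2 * β) 0 x) := by
    filter_upwards [ae_ne_bot hψ] with x hx
    have h2 := expMoment_mul hβ hβ 1 1 hx
    have h1 := expMoment_mul hβ hβ 0 1 hx
    have h0 := expMoment_mul hβ hβ 0 0 hx
    norm_num at h2 h1 h0
    rw [two_mul β, ← h2, ← h1, ← h0]
    simp only [siteY, ← hLdef, ← hD]
    field_simp
    ring
  have i2 := integrable_expMoment hψ hβ2 2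
  have i1 := (integrable_expMoment hψ hβ2 1).const_mul (2 * D)
  have i0 := (integrable_expMoment hψ hβ2 0).const_mul (D ^ 2)
  have i21 : Integrable (fun x => expMoment (2 * β) 2 x + 2 * D * expMoment (2 * β) 1 x) μ :=
    i2.add i1
  rw [integral_congr_ae h, integral_const_mul, integral_add i21 i0, integral_add i2 i1,
    integral_const_mul, integral_const_mul, Real.exp_sub, two_mul (psi μ β), Real.exp_add,
    exp_psi hμ hψ hβ, exp_psi hμ hψ hβ2, deriv_psi hψ hβ2, deriv_deriv_psi hψ hβ2, ← hLdef]
  field_simp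
  ring

end law

/-! ### Leibniz rule for finite products. -/

section algebra

variable {ι : Type*} [DecidableEq ι]

/-- The derivative of `∏ e ∈ Δ, x e` in the direction `y`. -/
def prodDeriv (x y : ι → ℝ) (Δ : Finset ι) : ℝ :=
  ∑ e ∈ Δ, y e * ∏ f ∈ Δ.erase e, x f

lemma prodDeriv_insert (x y : ι → ℝ) {a : ι} {s : Finset ι} (ha : a ∉ s) :
    prodDeriv x y (insert a s) = y a * ∏ f ∈ s, x f + x a * prodDeriv x y s := by
  rw [prodDeriv, Finset.sum_insert ha, Finset.erase_insert ha, prodDeriv, Finset.mul_sum]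
  congr 1
  refine Finset.sum_congr rfl fun e he => ?_
  have hea : a ≠ e := fun h => ha (h ▸ he)
  rw [Finset.erase_insert_of_ne hea, Finset.prod_insert (fun h => ha (Finset.mem_of_mem_erase h))]
  ring

/-- Both sides differentiate ∏ (1 + x_e) = ∑_Δ ∏_{e∈Δ} x_e in the direction y. -/
lemma sum_powerset_prodDeriv (x y : ι → ℝ) (s : Finset ι) :
    ∑ Δ ∈ s.powerset, prodDeriv x y Δ = prodDeriv (fun e => 1 + x e) y s := by
  induction s using Finset.induction_on with
  | empty => simp [prodDeriv]
  | insert a s ha ih =>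
    rw [Finset.sum_powerset_insert ha, prodDeriv_insert _ _ ha, ih, Finset.prod_one_add]
    have : ∀ t ∈ s.powerset, prodDeriv x y (insert a t) =
        y a * ∏ f ∈ t, x f + x a * prodDeriv x y t := fun t ht =>
      prodDeriv_insert _ _ fun h => ha (Finset.mem_powerset.1 ht h)
    rw [Finset.sum_congr rfl this, Finset.sum_add_distrib, ← Finset.mul_sum, ← Finset.mul_sum, ih]
    ring

lemma prodDeriv_const_mul (p : ℝ) (x y : ι → ℝ) (Δ : Finset ι) :
    prodDeriv (fun e => p * x e) (fun e => p * y e) Δ = p ^ Δ.card * prodDeriv x y Δ := by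
  rw [prodDeriv, prodDeriv, Finset.mul_sum]
  refine Finset.sum_congr rfl fun e he => ?_
  rw [Finset.prod_mul_distrib, Finset.prod_const, ← Finset.card_erase_add_one he, pow_succ]
  ring

lemma prodDeriv_eq_prod_mul_sum (x y : ι → ℝ) (Δ : Finset ι) (hx : ∀ e ∈ Δ, x e ≠ 0) :
    prodDeriv x y Δ = (∏ e ∈ Δ, x e) * ∑ e ∈ Δ, y e / x e := by
  rw [prodDeriv, Finset.mul_sum]
  refine Finset.sum_congr rfl fun e he => ?_
  rw [← Finset.mul_prod_erase Δ x he]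
  have := hx e he
  field_simp

end algebra

/-! ### Orthogonal cluster monomials on a product space. -/

section product

variable {ι : Type*} [Fintype ι] [DecidableEq ι] {E : Type*} [MeasurableSpace E]

/-- The factor at the site `f` of a cluster monomial on `Δ` with at most one marked site. -/
def markFactor (x y : E → ℝ) (o : Option ι) (Δ : Finset ι) (f : ι) : E → ℝ :=
  if o = some f then y else if f ∈ Δ then x else fun _ => 1

variable {x y : E → ℝ}

omit [MeasurableSpace E] in
lemma prod_markFactor_none (Δ : Finset ι) (w : ι → E) :
    ∏ f, markFactor x y none Δ f (w f) = ∏ f ∈ Δ, x (w f) := by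
  simp only [markFactor, reduceCtorEq, if_false]
  rw [← Finset.prod_subset (Finset.subset_univ Δ)]
  · exact Finset.prod_congr rfl fun f hf => by simp [hf]
  · intro f _ hf
    simp [hf]

-- The mark records which factor the Leibniz rule differentiates. Each summand is a product over all
-- sites, so its integrals factorise.
omit [MeasurableSpace E] in
lemma sum_prod_markFactor (Δ : Finset ι) (w : ι → E) :
    ∑ e ∈ Δ, ∏ f, markFactor x y (some e) Δ f (w f) =
      prodDeriv (fun e => x (w e)) (fun e => y (w e)) Δ := by
  refine Finset.sum_congr rfl fun e he => ?_
  rw [← Finset.mul_prod_erase Finset.univ _ (Finset.mem_univ e)]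
  congr 1
  · simp [markFactor]
  · rw [← Finset.prod_subset (Finset.erase_subset_erase e (Finset.subset_univ Δ))]
    · refine Finset.prod_congr rfl fun f hf => ?_
      rw [Finset.mem_erase] at hf
      simp [markFactor, hf.2, hf.1.symm]
    · intro f hf hf'
      simp only [Finset.mem_erase, Finset.mem_univ, and_true, not_and] at hf hf'
      simp [markFactor, hf' hf, Ne.symm hf]

variable {μ : Measure E} [IsProbabilityMeasure μ]

omit [Fintype ι] in
lemma memLp_markFactor (hx : MemLp x 2 μ) (hy : MemLp y 2 μ) (o : Option ι) (Δ : Finset ι)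
    (f : ι) : MemLp (markFactor x y o Δ f) 2 μ := by
  unfold markFactor
  split_ifs
  exacts [hy, hx, memLp_const 1]

omit [DecidableEq ι] in
lemma memLp_prod {h : ι → E → ℝ} (hh : ∀ f, MemLp (h f) 2 μ) :
    MemLp (fun w : ι → E => ∏ f, h f (w f)) 2 (Measure.pi fun _ : ι => μ) := by
  have h1 : Integrable (fun w : ι → E => ∏ f, h f (w f)) (Measure.pi fun _ : ι => μ) :=
    Integrable.fintype_prod fun f => (hh f).integrable (by norm_num)
  rw [memLp_two_iff_integrable_sq h1.aestronglyMeasurable]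
  have h2 : Integrable (fun w : ι → E => ∏ f, h f (w f) ^ 2) (Measure.pi fun _ : ι => μ) :=
    Integrable.fintype_prod (f := fun f z => h f z ^ 2) fun f => (hh f).integrable_sq
  simpa [Finset.prod_pow] using h2

omit [DecidableEq ι] in
lemma integral_prod_mul_prod (h k : ι → E → ℝ) :
    ∫ w : ι → E, (∏ f, h f (w f)) * ∏ f, k f (w f) ∂(Measure.pi fun _ : ι => μ) =
      ∏ f, ∫ z, h f z * k f z ∂μ := by
  simp_rw [← Finset.prod_mul_distrib]
  exact integral_fintype_prod_eq_prod (fun f z => h f z * k f z)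

omit [Fintype ι] [IsProbabilityMeasure μ] in
lemma integral_markFactor_eq_zero (hx0 : ∫ z, x z ∂μ = 0) (hy0 : ∫ z, y z ∂μ = 0)
    (o : Option ι) {Δ : Finset ι} {f : ι} (hf : f ∈ Δ) :
    ∫ z, markFactor x y o Δ f z ∂μ = 0 := by
  unfold markFactor
  split_ifs
  exacts [hy0, hx0]

omit [Fintype ι] [MeasurableSpace E] in
lemma markFactor_eq_one {o : Option ι} {Δ : Finset ι} (ho : ∀ e ∈ o, e ∈ Δ) {f : ι}
    (hf : f ∉ Δ) (z : E) : markFactor x y o Δ f z = 1 := by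
  have : o ≠ some f := fun h => hf (ho f h)
  simp [markFactor, this, hf]

/-- At a site in exactly one of the two clusters, one factor is centred and the other is 1, the
marks lying inside their clusters; that site's integral is 0. -/
lemma integral_markFactor_mul_eq_zero (hx0 : ∫ z, x z ∂μ = 0) (hy0 : ∫ z, y z ∂μ = 0)
    {o o' : Option ι} {Δ Δ' : Finset ι} (ho : ∀ e ∈ o, e ∈ Δ) (ho' : ∀ e ∈ o', e ∈ Δ')
    (hne : Δ ≠ Δ') :
    ∫ w : ι → E, (∏ f, markFactor x y o Δ f (w f)) * ∏ f, markFactor x y o' Δ' f (w f)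
      ∂(Measure.pi fun _ : ι => μ) = 0 := by
  rw [integral_prod_mul_prod]
  have : ∃ f, (f ∈ Δ ∧ f ∉ Δ') ∨ (f ∈ Δ' ∧ f ∉ Δ) := by
    by_contra! h
    exact hne (Finset.ext fun f => ⟨(h f).1, (h f).2⟩)
  obtain ⟨f, hf | hf⟩ := this
  · refine Finset.prod_eq_zero (Finset.mem_univ f) ?_
    simp only [markFactor_eq_one ho' hf.2, mul_one]
    exact integral_markFactor_eq_zero hx0 hy0 o hf.1
  · refine Finset.prod_eq_zero (Finset.mem_univ f) ?_
    simp only [markFactor_eq_one ho hf.2, one_mul]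
    exact integral_markFactor_eq_zero hx0 hy0 o' hf.1

lemma integral_sq_markFactor_le {o : Option ι} {Δ : Finset ι} (ho : ∀ e ∈ o, e ∈ Δ) :
    ∫ w : ι → E, (∏ f, markFactor x y o Δ f (w f)) ^ 2 ∂(Measure.pi fun _ : ι => μ) ≤
      (1 + ∫ z, x z ^ 2 ∂μ + ∫ z, y z ^ 2 ∂μ) ^ Δ.card := by
  have hX : 0 ≤ ∫ z, x z ^ 2 ∂μ := integral_nonneg fun z => sq_nonneg _
  have hY : 0 ≤ ∫ z, y z ^ 2 ∂μ := integral_nonneg fun z => sq_nonneg _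
  simp_rw [pow_two (∏ f, _)]
  rw [integral_prod_mul_prod, ← Finset.prod_const, ← Finset.prod_subset (Finset.subset_univ Δ)]
  · refine Finset.prod_le_prod (fun f _ => integral_nonneg fun z => mul_self_nonneg _) ?_
    intro f hf
    simp_rw [← pow_two, markFactor]
    split_ifs <;> linarith
  · intro f _ hf
    simp [markFactor_eq_one ho hf]

/-- Orthogonal families indexed by clusters with exponential second moment bounds. -/
structure IsClusterFamily (u : Finset ι → (ι → E) → ℝ) (μ : Measure E) (C : ℝ) : Prop where
  memLp : ∀ Δ, MemLp (u Δ) 2 (Measure.pi fun _ : ι => μ)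
  orthogonal : ∀ Δ Δ', Δ ≠ Δ' → ∫ w, u Δ w * u Δ' w ∂(Measure.pi fun _ : ι => μ) = 0
  bound : ∀ Δ, ∫ w, u Δ w ^ 2 ∂(Measure.pi fun _ : ι => μ) ≤ C ^ Δ.card

omit [DecidableEq ι] [IsProbabilityMeasure μ] in
lemma IsClusterFamily.memLp_sum {u : Finset ι → (ι → E) → ℝ} {C : ℝ}
    (hu : IsClusterFamily u μ C) (a : Finset ι → ℝ) :
    MemLp (fun w => ∑ Δ, a Δ * u Δ w) 2 (Measure.pi fun _ : ι => μ) :=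
  memLp_finsetSum _ fun Δ _ => (hu.memLp Δ).const_mul (a Δ)

-- Pythagoras: orthogonality kills the cross terms.
omit [DecidableEq ι] [IsProbabilityMeasure μ] in
lemma IsClusterFamily.integral_sq_sum_le {u : Finset ι → (ι → E) → ℝ} {C : ℝ}
    (hu : IsClusterFamily u μ C) (a : Finset ι → ℝ) :
    ∫ w, (∑ Δ, a Δ * u Δ w) ^ 2 ∂(Measure.pi fun _ : ι => μ) ≤
      ∑ Δ, a Δ ^ 2 * C ^ Δ.card := by
  have hint : ∀ Δ Δ', Integrable (fun w => (a Δ * u Δ w) * (a Δ' * u Δ' w))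
      (Measure.pi fun _ : ι => μ) := fun Δ Δ' =>
    ((hu.memLp Δ).const_mul (a Δ)).integrable_mul ((hu.memLp Δ').const_mul (a Δ'))
  simp_rw [pow_two (∑ Δ, _), Finset.sum_mul_sum]
  rw [integral_finsetSum _ fun Δ _ => integrable_finsetSum _ fun Δ' _ => hint Δ Δ']
  refine Finset.sum_le_sum fun Δ _ => ?_
  rw [integral_finsetSum _ fun Δ' _ => hint Δ Δ', Finset.sum_eq_single Δ]
  · have : ∀ w, a Δ * u Δ w * (a Δ * u Δ w) = a Δ ^ 2 * u Δ w ^ 2 := fun w => by ring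
    simp_rw [this, integral_const_mul]
    exact mul_le_mul_of_nonneg_left (hu.bound Δ) (sq_nonneg _)
  · intro Δ' _ hne
    have : ∀ w, a Δ * u Δ w * (a Δ' * u Δ' w) = a Δ * a Δ' * (u Δ w * u Δ' w) := fun w => by ring
    simp_rw [this, integral_const_mul, hu.orthogonal Δ Δ' hne.symm, mul_zero]
  · simp

lemma isClusterFamily_prod (hx : MemLp x 2 μ) (hx0 : ∫ z, x z ∂μ = 0) :
    IsClusterFamily (fun (Δ : Finset ι) w => ∏ f ∈ Δ, x (w f)) μ (1 + ∫ z, x z ^ 2 ∂μ) where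
  memLp Δ := by
    simp_rw [← prod_markFactor_none (x := x) (y := fun _ => 0)]
    exact memLp_prod fun f => memLp_markFactor hx (memLp_const 0) _ _ _
  orthogonal Δ Δ' hne := by
    simp_rw [← prod_markFactor_none (x := x) (y := fun _ => 0)]
    exact integral_markFactor_mul_eq_zero hx0 (by simp) (by simp) (by simp) hne
  bound Δ := by
    simp_rw [← prod_markFactor_none (x := x) (y := fun _ => 0)]
    exact (integral_sq_markFactor_le (by simp)).trans_eq (by simp)

lemma isClusterFamily_prodDeriv (hx : MemLp x 2 μ) (hy : MemLp y 2 μ) (hx0 : ∫ z, x z ∂μ = 0)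
    (hy0 : ∫ z, y z ∂μ = 0) :
    IsClusterFamily
      (fun (Δ : Finset ι) w => prodDeriv (fun e => x (w e)) (fun e => y (w e)) Δ) μ
      (4 * (1 + ∫ z, x z ^ 2 ∂μ + ∫ z, y z ^ 2 ∂μ)) where
  memLp Δ := by
    simp_rw [← sum_prod_markFactor]
    exact memLp_finsetSum _ fun e _ => memLp_prod fun f => memLp_markFactor hx hy _ _ _
  orthogonal Δ Δ' hne := by
    simp_rw [← sum_prod_markFactor, Finset.sum_mul_sum]
    have hint : ∀ e e', Integrable (fun w : ι → E =>
        (∏ f, markFactor x y (some e) Δ f (w f)) * ∏ f, markFactor x y (some e') Δ' f (w f))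
        (Measure.pi fun _ : ι => μ) := fun e e' =>
      (memLp_prod fun f => memLp_markFactor hx hy _ _ _).integrable_mul
        (memLp_prod fun f => memLp_markFactor hx hy _ _ _)
    rw [integral_finsetSum _ fun e _ => integrable_finsetSum _ fun e' _ => hint e e']
    refine Finset.sum_eq_zero fun e he => ?_
    rw [integral_finsetSum _ fun e' _ => hint e e']
    exact Finset.sum_eq_zero fun e' he' =>
      integral_markFactor_mul_eq_zero hx0 hy0 (by simpa using he) (by simpa using he') hne
  bound Δ := by
    simp_rw [← sum_prod_markFactor]
    set M := 1 + ∫ z, x z ^ 2 ∂μ + ∫ z, y z ^ 2 ∂μ with hM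
    have hX : 0 ≤ ∫ z, x z ^ 2 ∂μ := integral_nonneg fun z => sq_nonneg _
    have hY : 0 ≤ ∫ z, y z ^ 2 ∂μ := integral_nonneg fun z => sq_nonneg _
    have hM0 : 0 ≤ M := by positivity
    have hint : ∀ e, Integrable (fun w : ι → E =>
        (∏ f, markFactor x y (some e) Δ f (w f)) ^ 2) (Measure.pi fun _ : ι => μ) := fun e =>
      (memLp_prod fun f => memLp_markFactor hx hy _ _ _).integrable_sq
    calc ∫ w : ι → E, (∑ e ∈ Δ, ∏ f, markFactor x y (some e) Δ f (w f)) ^ 2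
          ∂(Measure.pi fun _ : ι => μ)
        ≤ ∫ w : ι → E, Δ.card * ∑ e ∈ Δ, (∏ f, markFactor x y (some e) Δ f (w f)) ^ 2
          ∂(Measure.pi fun _ : ι => μ) := by
          refine integral_mono_of_nonneg (ae_of_all _ fun w => sq_nonneg _)
            ((integrable_finsetSum _ fun e _ => hint e).const_mul _)
            (ae_of_all _ fun w => sq_sum_le_card_mul_sum_sq)
      _ ≤ Δ.card * ∑ e ∈ Δ, M ^ Δ.card := by
          rw [integral_const_mul, integral_finsetSum _ fun e _ => hint e]
          gcongr with e he
          exact integral_sq_markFactor_le (by simpa using he)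
      _ = (Δ.card * Δ.card : ℝ) * M ^ Δ.card := by
          rw [Finset.sum_const, nsmul_eq_mul]; ring
      -- One factor |Δ| comes from Cauchy–Schwarz, the other from the number of marks; both are
      -- absorbed by k ≤ 2^k.
      _ ≤ (4 * M) ^ Δ.card := by
          rw [mul_pow, show (4 : ℝ) = 2 * 2 by norm_num, mul_pow (2 : ℝ)]
          have : (Δ.card : ℝ) ≤ 2 ^ Δ.card := by
            exact_mod_cast Nat.lt_two_pow_self.le
          gcongr

end product

/-! ### Containment probabilities and sums over clusters. -/

section counting

variable {α : Type*}

-- Exchange the sums: Δ is counted once for each configuration containing it. This turns Gibbs sums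
-- into cluster sums.
open scoped Classical in
lemma sum_powerset_div_card [Fintype α] (S : Finset (Finset α)) (g : Finset α → ℝ) :
    (1 / (S.card : ℝ)) * ∑ π ∈ S, ∑ Δ ∈ π.powerset, g Δ = ∑ Δ, containProb S Δ * g Δ := by
  have h : ∀ π ∈ S, ∑ Δ ∈ π.powerset, g Δ = ∑ Δ, if Δ ⊆ π then g Δ else 0 := fun π _ => by
    rw [← Finset.sum_filter]
    congr 1
    ext; simp
  rw [Finset.sum_congr rfl h, Finset.sum_comm, Finset.mul_sum]
  refine Finset.sum_congr rfl fun Δ _ => ?_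
  rw [← Finset.sum_filter, Finset.sum_const, containProb, nsmul_eq_mul]
  ring

lemma containProb_nonneg (S : Finset (Finset α)) (Γ : Finset α) : 0 ≤ containProb S Γ := by
  unfold containProb; positivity

open scoped Classical in
lemma containProb_eq_zero {S : Finset (Finset α)} {Γ : Finset α} (h : ¬ ∃ π ∈ S, Γ ⊆ π) :
    containProb S Γ = 0 := by
  push Not at h
  simp [containProb, Finset.filter_eq_empty_iff.2 fun π hπ => h π hπ]

-- Double counting of incidences: the edge probabilities add up to the mean size of π.
open scoped Classical in
lemma sum_containProb_singleton [Fintype α] {S : Finset (Finset α)} (hS : S.Nonempty) {m : ℕ}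
    (hm : ∀ π ∈ S, π.card = m) : ∑ e, containProb S {e} = m := by
  have hS' : (S.card : ℝ) ≠ 0 := by exact_mod_cast hS.card_ne_zero
  simp only [containProb, Finset.singleton_subset_iff]
  rw [← Finset.sum_div, div_eq_iff hS']
  have : ∑ e : α, (S.filter fun π => e ∈ π).card = ∑ π ∈ S, π.card := by
    simp_rw [Finset.card_filter]
    rw [Finset.sum_comm]
    simp
  rw [Finset.sum_congr rfl hm, Finset.sum_const, smul_eq_mul] at this
  rw [← Nat.cast_sum, this]
  push_cast; ring

lemma containProb_singleton_eq [Fintype α] {S : Finset (Finset α)} (hS : S.Nonempty) {m : ℕ}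
    (hm : ∀ π ∈ S, π.card = m)
    (hedge : ∀ e f, containProb S {e} = containProb S {f}) (e : α) :
    containProb S {e} = m / Nat.card α := by
  have h := sum_containProb_singleton hS hm
  rw [Finset.sum_congr rfl fun f _ => hedge f e, Finset.sum_const, nsmul_eq_mul,
    Finset.card_univ, ← Nat.card_eq_fintype_card] at h
  have : (Nat.card α : ℝ) ≠ 0 := by
    have : Nonempty α := ⟨e⟩
    exact_mod_cast Nat.card_pos.ne'
  rw [eq_div_iff this, ← h, mul_comm]

/-- The sum is (1 + q)^N by the binomial theorem, and 1 + q ≤ e^q. -/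
lemma sum_pow_card_le_exp [Fintype α] {q : ℝ} (hq : 0 ≤ q) :
    ∑ Δ : Finset α, q ^ Δ.card ≤ Real.exp (Nat.card α * q) := by
  have h := Fintype.sum_pow_mul_eq_add_pow α q 1
  simp only [one_pow, mul_one] at h
  rw [h, Real.exp_nat_mul, Nat.card_eq_fintype_card, add_comm]
  gcongr
  linarith [Real.add_one_le_exp q]

-- Split Δ into T and Δ \ T; the part outside T is summed over all finite sets.
open scoped Classical in
lemma sum_superset_pow_card_le [Fintype α] {q : ℝ} (hq : 0 ≤ q) (T : Finset α) :
    ∑ Δ ∈ Finset.univ.filter (T ⊆ ·), q ^ Δ.card ≤ q ^ T.card * Real.exp (Nat.card α * q) := by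
  refine le_trans ?_ (mul_le_mul_of_nonneg_left (sum_pow_card_le_exp hq) (by positivity))
  have h : ∀ Δ ∈ Finset.univ.filter (T ⊆ ·), q ^ Δ.card = q ^ T.card * q ^ (Δ \ T).card := by
    intro Δ hΔ
    rw [← pow_add, add_comm, Finset.card_sdiff_add_card_eq_card (Finset.mem_filter.1 hΔ).2]
  rw [Finset.sum_congr rfl h, ← Finset.mul_sum]
  refine mul_le_mul_of_nonneg_left ?_ (by positivity)
  rw [← Finset.sum_image (f := fun Δ : Finset α => q ^ Δ.card) (g := fun Δ => Δ \ T)]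
  · exact Finset.sum_le_sum_of_subset_of_nonneg (Finset.subset_univ _) fun _ _ _ => by positivity
  · intro Δ hΔ Δ' hΔ' h
    simp only [Finset.coe_filter, Finset.mem_univ, true_and, Set.mem_ofPred_eq] at hΔ hΔ'
    rw [← Finset.sdiff_union_of_subset hΔ, ← Finset.sdiff_union_of_subset hΔ']
    simp only at h
    rw [h]

lemma sum_pow_card_le_of_forall_exists_subset [Fintype α] {q : ℝ} (hq : 0 ≤ q) {κ : Type*}
    {A : Finset κ} {T : κ → Finset α} {k : ℕ} (hT : ∀ a ∈ A, (T a).card = k)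
    {B : Finset (Finset α)} (hB : ∀ Δ ∈ B, ∃ a ∈ A, T a ⊆ Δ) :
    ∑ Δ ∈ B, q ^ Δ.card ≤ A.card * (q ^ k * Real.exp (Nat.card α * q)) := by
  classical
  have hterm : ∀ (Δ : Finset α) (a : κ), 0 ≤ if T a ⊆ Δ then q ^ Δ.card else 0 := fun Δ a => by
    split_ifs
    exacts [pow_nonneg hq _, le_rfl]
  calc ∑ Δ ∈ B, q ^ Δ.card
      ≤ ∑ Δ ∈ B, ∑ a ∈ A, (if T a ⊆ Δ then q ^ Δ.card else 0) := by
        refine Finset.sum_le_sum fun Δ hΔ => ?_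
        obtain ⟨a, ha, hsub⟩ := hB Δ hΔ
        have h := Finset.single_le_sum (fun a _ => hterm Δ a) ha
        rwa [if_pos hsub] at h
    _ ≤ ∑ Δ, ∑ a ∈ A, (if T a ⊆ Δ then q ^ Δ.card else 0) :=
        Finset.sum_le_sum_of_subset_of_nonneg (Finset.subset_univ _) fun Δ _ _ =>
          Finset.sum_nonneg fun a _ => hterm Δ a
    _ = ∑ a ∈ A, ∑ Δ ∈ Finset.univ.filter (T a ⊆ ·), q ^ Δ.card := by
        rw [Finset.sum_comm]
        exact Finset.sum_congr rfl fun a _ => (Finset.sum_filter _ _).symm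
    _ ≤ ∑ a ∈ A, q ^ k * Real.exp (Nat.card α * q) := by
        refine Finset.sum_le_sum fun a ha => ?_
        rw [← hT a ha]
        convert sum_superset_pow_card_le hq (T a)
    _ = _ := by
        rw [Finset.sum_const, nsmul_eq_mul]

end counting

/-! ### Adjacent edges and the non-matching clusters. -/

section graph

variable {V : Type*} [Finite V] {G : SimpleGraph V} [Fintype G.edgeSet]

/-- The ordered pairs of distinct edges that share a vertex. -/
noncomputable def adjacentPairs (G : SimpleGraph V) [Fintype G.edgeSet] :
    Finset (G.edgeSet × G.edgeSet) :=
  @Finset.filter _ (fun a => a.1 ≠ a.2 ∧ ∃ v : V, v ∈ (a.1 : Sym2 V) ∧ v ∈ (a.2 : Sym2 V))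
    (Classical.decPred _) Finset.univ

omit [Finite V] in
lemma mem_adjacentPairs {a : G.edgeSet × G.edgeSet} : a ∈ adjacentPairs G ↔
    a.1 ≠ a.2 ∧ ∃ v : V, v ∈ (a.1 : Sym2 V) ∧ v ∈ (a.2 : Sym2 V) := by
  simp [adjacentPairs]

/-- A shared vertex and the two opposite endpoints determine the ordered pair. -/
lemma card_adjacentPairs_le : (adjacentPairs G).card ≤ Nat.card V ^ 3 := by
  classical
  have := Fintype.ofFinite V
  let g : V × V × V → Sym2 V × Sym2 V := fun t => (s(t.1, t.2.1), s(t.1, t.2.2))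
  let h : G.edgeSet × G.edgeSet → Sym2 V × Sym2 V := fun a => (a.1, a.2)
  have hinj : Function.Injective h := fun a b hab => by
    simp only [h, Prod.mk.injEq] at hab
    exact Prod.ext (Subtype.ext hab.1) (Subtype.ext hab.2)
  have hsub : (adjacentPairs G).image h ⊆ Finset.univ.image g := by
    intro z hz
    obtain ⟨a, ha, rfl⟩ := Finset.mem_image.1 hz
    obtain ⟨-, v, ⟨b, hb⟩, ⟨d, hd⟩⟩ := mem_adjacentPairs.1 ha
    exact Finset.mem_image.2 ⟨(v, b, d), Finset.mem_univ _, by simp [g, h, ← hb, ← hd]⟩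
  calc (adjacentPairs G).card = ((adjacentPairs G).image h).card :=
        (Finset.card_image_of_injective _ hinj).symm
    _ ≤ (Finset.univ.image g).card := Finset.card_le_card hsub
    _ ≤ (Finset.univ : Finset (V × V × V)).card := Finset.card_image_le
    _ = Nat.card V ^ 3 := by
      rw [Finset.card_univ, Fintype.card_prod, Fintype.card_prod, Nat.card_eq_fintype_card]; ring

omit [Finite V] in
lemma exists_adjacentPairs_of_not_isPartialMatching [DecidableEq G.edgeSet]
    {Δ : Finset G.edgeSet} (hΔ : ¬ IsPartialMatching Δ) :
    ∃ a ∈ adjacentPairs G, {a.1, a.2} ⊆ Δ := by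
  simp only [IsPartialMatching] at hΔ
  push Not at hΔ
  obtain ⟨e, he, f, hf, hef, v, hv⟩ := hΔ
  exact ⟨(e, f), mem_adjacentPairs.2 ⟨hef, v, hv⟩, by simp [Finset.insert_subset_iff, he, hf]⟩

/-- Union bound over the adjacent pair that such a Δ must contain. -/
lemma sum_not_isPartialMatching_le {q : ℝ} (hq : 0 ≤ q)
    {B : Finset (Finset G.edgeSet)} (hB : ∀ Δ ∈ B, ¬ IsPartialMatching Δ) :
    ∑ Δ ∈ B, q ^ Δ.card ≤
      (Nat.card V : ℝ) ^ 3 * (q ^ 2 * Real.exp (Nat.card G.edgeSet * q)) := by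
  classical
  refine (sum_pow_card_le_of_forall_exists_subset hq (A := adjacentPairs G)
    (T := fun a => {a.1, a.2}) (k := 2)
    (fun a ha => Finset.card_pair (mem_adjacentPairs.1 ha).1)
    fun Δ hΔ => exists_adjacentPairs_of_not_isPartialMatching (hB Δ hΔ)).trans ?_
  refine mul_le_mul_of_nonneg_right ?_ (by positivity)
  calc ((adjacentPairs G).card : ℝ) ≤ ((Nat.card V ^ 3 : ℕ) : ℝ) :=
        Nat.cast_le.2 card_adjacentPairs_le
    _ = (Nat.card V : ℝ) ^ 3 := Nat.cast_pow _ _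

/-- Matchings are controlled by the relative error 1/√m, squared. The other clusters have only an
exponential bound, but they are scarce: an adjacent pair costs |V|³ p⁴. -/
lemma sum_sq_containProb_sub_le {S : Finset (Finset G.edgeSet)} {p ρ R m C : ℝ}
    (hm : 0 ≤ m) (hC : 0 ≤ C)
    (hmatch : ∀ Γ : Finset G.edgeSet, IsPartialMatching Γ →
      |containProb S Γ - p ^ Γ.card| ≤ p ^ Γ.card * (ρ ^ Γ.card / √m))
    (hnon : ∀ Γ : Finset G.edgeSet, ¬ IsPartialMatching Γ →
      |containProb S Γ - p ^ Γ.card| ≤ (R * p) ^ Γ.card) :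
    ∑ Γ, (containProb S Γ - p ^ Γ.card) ^ 2 * C ^ Γ.card ≤
      Real.exp (ρ ^ 2 * C * (Nat.card G.edgeSet * p ^ 2)) / m +
      (R ^ 2 * C) ^ 2 * ((Nat.card V : ℝ) ^ 3 * p ^ 4) *
        Real.exp (R ^ 2 * C * (Nat.card G.edgeSet * p ^ 2)) := by
  classical
  rw [← Finset.sum_filter_add_sum_filter_not Finset.univ
    (fun Γ : Finset G.edgeSet => IsPartialMatching Γ)]
  refine add_le_add ?_ ?_
  · calc _ ≤ ∑ Γ ∈ Finset.univ.filter (fun Γ : Finset G.edgeSet => IsPartialMatching Γ),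
          (ρ ^ 2 * C * p ^ 2) ^ Γ.card / m := by
          refine Finset.sum_le_sum fun Γ hΓ => ?_
          have h := hmatch Γ (Finset.mem_filter.1 hΓ).2
          have h2 := pow_le_pow_left₀ (abs_nonneg _) h 2
          rw [sq_abs] at h2
          refine (mul_le_mul_of_nonneg_right h2 (by positivity)).trans_eq ?_
          rw [mul_pow, div_pow, Real.sq_sqrt hm]
          ring
      _ ≤ ∑ Γ : Finset G.edgeSet, (ρ ^ 2 * C * p ^ 2) ^ Γ.card / m :=
          Finset.sum_le_sum_of_subset_of_nonneg (Finset.subset_univ _) fun _ _ _ => by positivity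
      _ ≤ _ := by
          rw [← Finset.sum_div]
          gcongr
          refine (sum_pow_card_le_exp (by positivity)).trans_eq ?_
          ring_nf
  · calc _ ≤ ∑ Γ ∈ Finset.univ.filter (fun Γ : Finset G.edgeSet => ¬ IsPartialMatching Γ),
          (R ^ 2 * C * p ^ 2) ^ Γ.card := by
          refine Finset.sum_le_sum fun Γ hΓ => ?_
          have h := hnon Γ (Finset.mem_filter.1 hΓ).2
          have h2 := pow_le_pow_left₀ (abs_nonneg _) h 2
          rw [sq_abs] at h2
          refine (mul_le_mul_of_nonneg_right h2 (by positivity)).trans_eq ?_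
          ring
      _ ≤ _ := by
          refine (sum_not_isPartialMatching_le (by positivity)
            fun Γ hΓ => (Finset.mem_filter.1 hΓ).2).trans_eq ?_
          ring_nf

end graph

lemma norm_exp_ofReal_mul_I_sub_le (a b : ℝ) :
    ‖Complex.exp (a * Complex.I) - Complex.exp (b * Complex.I)‖ ≤ |a - b| := by
  have h := Real.norm_exp_I_mul_ofReal_sub_one_le (x := a - b)
  have e : Complex.exp (a * Complex.I) - Complex.exp (b * Complex.I) =
      Complex.exp (b * Complex.I) * (Complex.exp (Complex.I * ((a - b : ℝ) : ℂ)) - 1) := by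
    rw [mul_sub, ← Complex.exp_add]
    push_cast
    ring_nf
  rw [e, norm_mul, Complex.norm_exp_ofReal_mul_I, one_mul]
  exact h

/-! ### Convergence and boundedness in probability on varying spaces. -/

section InProbability

variable {Ω : ℕ → Type*} [∀ n, MeasurableSpace (Ω n)] {Q : ∀ n, Measure (Ω n)}
  {X Y : ∀ n, Ω n → ℝ}

/-- Convergence to `0` in probability, for variables on varying spaces. -/
def NegligibleInProb (Q : ∀ n, Measure (Ω n)) (X : ∀ n, Ω n → ℝ) : Prop :=
  ∀ δ : ℝ, 0 < δ → ∀ ε : ℝ≥0∞, 0 < ε → ∀ᶠ n in atTop, Q n {ω | δ ≤ |X n ω|} ≤ ε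

/-- Boundedness in probability, for variables on varying spaces. -/
def BoundedInProb (Q : ∀ n, Measure (Ω n)) (X : ∀ n, Ω n → ℝ) : Prop :=
  ∀ ε : ℝ≥0∞, 0 < ε → ∃ K : ℝ, 0 < K ∧ ∀ᶠ n in atTop, Q n {ω | K ≤ |X n ω|} ≤ ε

lemma NegligibleInProb.mono (hY : NegligibleInProb Q Y)
    (h : ∀ᶠ n in atTop, ∀ ω, |X n ω| ≤ |Y n ω|) : NegligibleInProb Q X := fun δ hδ ε hε => by
  filter_upwards [hY δ hδ ε hε, h] with n h1 h2
  exact (measure_mono fun ω (hω : δ ≤ |X n ω|) => hω.trans (h2 ω)).trans h1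

lemma NegligibleInProb.neg (hY : NegligibleInProb Q Y) :
    NegligibleInProb Q fun n ω => -Y n ω :=
  hY.mono (.of_forall fun _ _ => (abs_neg _).le)

lemma BoundedInProb.mono (hY : BoundedInProb Q Y)
    (h : ∀ᶠ n in atTop, ∀ ω, |X n ω| ≤ |Y n ω|) : BoundedInProb Q X := fun ε hε => by
  obtain ⟨K, hK, hK'⟩ := hY ε hε
  refine ⟨K, hK, ?_⟩
  filter_upwards [hK', h] with n h1 h2
  exact (measure_mono fun ω (hω : K ≤ |X n ω|) => hω.trans (h2 ω)).trans h1

lemma NegligibleInProb.add (hX : NegligibleInProb Q X) (hY : NegligibleInProb Q Y) :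
    NegligibleInProb Q fun n ω => X n ω + Y n ω := fun δ hδ ε hε => by
  filter_upwards [hX (δ / 2) (by positivity) (ε / 2) (ENNReal.half_pos hε.ne'),
    hY (δ / 2) (by positivity) (ε / 2) (ENNReal.half_pos hε.ne')] with n h1 h2
  have hsub : {ω | δ ≤ |X n ω + Y n ω|} ⊆ {ω | δ / 2 ≤ |X n ω|} ∪ {ω | δ / 2 ≤ |Y n ω|} := by
    intro ω (hω : δ ≤ _)
    by_contra hcon
    simp only [Set.mem_union, Set.mem_ofPred_eq, not_or, not_le] at hcon
    linarith [abs_add_le (X n ω) (Y n ω)]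
  exact ((measure_mono hsub).trans (measure_union_le _ _)).trans
    ((add_le_add h1 h2).trans_eq (ENNReal.add_halves ε))

lemma BoundedInProb.add (hX : BoundedInProb Q X) (hY : BoundedInProb Q Y) :
    BoundedInProb Q fun n ω => X n ω + Y n ω := fun ε hε => by
  obtain ⟨K, hK, hK'⟩ := hX (ε / 2) (ENNReal.half_pos hε.ne')
  obtain ⟨L, hL, hL'⟩ := hY (ε / 2) (ENNReal.half_pos hε.ne')
  refine ⟨K + L, by positivity, ?_⟩
  filter_upwards [hK', hL'] with n h1 h2
  have hsub : {ω | K + L ≤ |X n ω + Y n ω|} ⊆ {ω | K ≤ |X n ω|} ∪ {ω | L ≤ |Y n ω|} := by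
    intro ω (hω : K + L ≤ _)
    by_contra hcon
    simp only [Set.mem_union, Set.mem_ofPred_eq, not_or, not_le] at hcon
    linarith [abs_add_le (X n ω) (Y n ω)]
  exact ((measure_mono hsub).trans (measure_union_le _ _)).trans
    ((add_le_add h1 h2).trans_eq (ENNReal.add_halves ε))

lemma NegligibleInProb.bounded (hX : NegligibleInProb Q X) : BoundedInProb Q X :=
  fun ε hε => ⟨1, one_pos, hX 1 one_pos ε hε⟩

lemma BoundedInProb.mul_negligible (hX : BoundedInProb Q X) (hY : NegligibleInProb Q Y) :
    NegligibleInProb Q fun n ω => X n ω * Y n ω := fun δ hδ ε hε => by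
  obtain ⟨K, hK, hK'⟩ := hX (ε / 2) (ENNReal.half_pos hε.ne')
  filter_upwards [hK', hY (δ / K) (by positivity) (ε / 2) (ENNReal.half_pos hε.ne')] with n h1 h2
  have hsub : {ω | δ ≤ |X n ω * Y n ω|} ⊆ {ω | K ≤ |X n ω|} ∪ {ω | δ / K ≤ |Y n ω|} := by
    intro ω (hω : δ ≤ _)
    by_contra hcon
    simp only [Set.mem_union, Set.mem_ofPred_eq, not_or, not_le] at hcon
    have h3 : |X n ω| * |Y n ω| ≤ K * |Y n ω| := by gcongr; exact hcon.1.le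
    have h4 : K * |Y n ω| < K * (δ / K) := by gcongr; exact hcon.2
    rw [mul_div_cancel₀ _ hK.ne'] at h4
    rw [abs_mul] at hω
    linarith
  exact ((measure_mono hsub).trans (measure_union_le _ _)).trans
    ((add_le_add h1 h2).trans_eq (ENNReal.add_halves ε))

lemma BoundedInProb.exp (hX : BoundedInProb Q X) :
    BoundedInProb Q fun n ω => Real.exp (X n ω) := fun ε hε => by
  obtain ⟨K, hK, hK'⟩ := hX ε hε
  refine ⟨Real.exp K, Real.exp_pos _, ?_⟩
  filter_upwards [hK'] with n h1
  refine (measure_mono fun ω (hω : Real.exp K ≤ |Real.exp (X n ω)|) => ?_).trans h1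
  rw [abs_of_pos (Real.exp_pos _), Real.exp_le_exp] at hω
  exact hω.trans (le_abs_self _)

lemma NegligibleInProb.of_sq (hX : NegligibleInProb Q fun n ω => X n ω ^ 2) :
    NegligibleInProb Q X := fun δ hδ ε hε => by
  filter_upwards [hX (δ ^ 2) (by positivity) ε hε] with n h1
  refine (measure_mono fun ω (hω : δ ≤ |X n ω|) => ?_).trans h1
  simpa using pow_le_pow_left₀ hδ.le hω 2

lemma BoundedInProb.of_sq (hX : BoundedInProb Q fun n ω => X n ω ^ 2) :
    BoundedInProb Q X := fun ε hε => by
  obtain ⟨K, hK, hK'⟩ := hX ε hε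
  -- With K + 1 in place of K, squaring yields at least K even when K < 1.
  refine ⟨K + 1, by positivity, ?_⟩
  filter_upwards [hK'] with n h1
  refine (measure_mono fun ω (hω : K + 1 ≤ |X n ω|) => ?_).trans h1
  show K ≤ |X n ω ^ 2|
  rw [abs_pow]
  nlinarith

variable [∀ n, IsProbabilityMeasure (Q n)]

lemma measure_le_ofReal_of_integral {n : ℕ} {δ : ℝ} (hδ : 0 < δ) (hX : Integrable (X n) (Q n)) :
    Q n {ω | δ ≤ |X n ω|} ≤ ENNReal.ofReal ((∫ ω, |X n ω| ∂Q n) / δ) := by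
  have h := mul_meas_ge_le_integral_of_nonneg (ae_of_all _ fun ω => abs_nonneg (X n ω)) hX.abs δ
  rw [← ofReal_measureReal (measure_ne_top _ _)]
  apply ENNReal.ofReal_le_ofReal
  rw [le_div_iff₀ hδ, mul_comm]
  exact h

lemma NegligibleInProb.of_integral (hX : ∀ᶠ n in atTop, Integrable (X n) (Q n))
    (h : Tendsto (fun n => ∫ ω, |X n ω| ∂Q n) atTop (𝓝 0)) : NegligibleInProb Q X :=
  fun δ hδ ε hε => by
  have h1 : Tendsto (fun n => ENNReal.ofReal ((∫ ω, |X n ω| ∂Q n) / δ)) atTop (𝓝 0) := by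
    have := ENNReal.tendsto_ofReal (h.div_const δ)
    simpa using this
  filter_upwards [hX, ENNReal.tendsto_nhds_zero.1 h1 ε hε] with n h2 h3
  exact (measure_le_ofReal_of_integral hδ h2).trans h3

lemma BoundedInProb.of_integral (hX : ∀ᶠ n in atTop, Integrable (X n) (Q n)) {M : ℝ}
    (h : ∀ᶠ n in atTop, ∫ ω, |X n ω| ∂Q n ≤ M) : BoundedInProb Q X := fun ε hε => by
  have h1 : Tendsto (fun K : ℝ => ENNReal.ofReal (M / K)) atTop (𝓝 0) := by
    have := ENNReal.tendsto_ofReal (tendsto_const_nhds (x := M).div_atTop tendsto_id)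
    simpa using this
  obtain ⟨K, hK1, hK2⟩ := ((ENNReal.tendsto_nhds_zero.1 h1 ε hε).and
    (eventually_gt_atTop 0)).exists
  refine ⟨K, hK2, ?_⟩
  filter_upwards [hX, h] with n h2 h3
  refine (measure_le_ofReal_of_integral hK2 h2).trans (le_trans ?_ hK1)
  apply ENNReal.ofReal_le_ofReal
  gcongr

lemma NegligibleInProb.of_integral_sq (hX : ∀ᶠ n in atTop, MemLp (X n) 2 (Q n))
    (h : Tendsto (fun n => ∫ ω, X n ω ^ 2 ∂Q n) atTop (𝓝 0)) : NegligibleInProb Q X :=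
  .of_sq (.of_integral (hX.mono fun n hn => hn.integrable_sq) (by simpa using h))

lemma BoundedInProb.of_integral_sq (hX : ∀ᶠ n in atTop, MemLp (X n) 2 (Q n)) {M : ℝ}
    (h : ∀ᶠ n in atTop, ∫ ω, X n ω ^ 2 ∂Q n ≤ M) : BoundedInProb Q X :=
  .of_sq (.of_integral (hX.mono fun n hn => hn.integrable_sq) (by simpa using h))

omit [∀ n, IsProbabilityMeasure (Q n)] in
/-- Stability of quotients under negligible perturbations of numerator and denominator. -/
lemma negligible_div_sub_div {N Z N₀ Z₀ W : ∀ n, Ω n → ℝ}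
    (hN : NegligibleInProb Q fun n ω => N n ω - N₀ n ω)
    (hZ : NegligibleInProb Q fun n ω => Z n ω - Z₀ n ω)
    (hZ₀ : ∀ᶠ n in atTop, ∀ ω, Z₀ n ω ≠ 0)
    (hinv : BoundedInProb Q fun n ω => (Z₀ n ω)⁻¹)
    (hquot : BoundedInProb Q fun n ω => N₀ n ω / Z₀ n ω)
    (hW : ∀ᶠ n in atTop, ∀ᵐ ω ∂Q n, Z n ω ≠ 0 → W n ω = N n ω / Z n ω) :
    NegligibleInProb Q fun n ω => W n ω - N₀ n ω / Z₀ n ω := by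
  have hD := hinv.mul_negligible hZ
  have hA := (hinv.mul_negligible hN).add (hquot.mul_negligible hD.neg)
  intro δ hδ ε hε
  filter_upwards [hD (1 / 2) (by norm_num) (ε / 2) (ENNReal.half_pos hε.ne'),
    hA (δ / 2) (by positivity) (ε / 2) (ENNReal.half_pos hε.ne'), hZ₀, hW] with n h1 h2 h3 h4
  refine ((measure_mono_ae (t := _ ∪ _) ?_).trans (measure_union_le _ _)).trans
    ((add_le_add h1 h2).trans_eq (ENNReal.add_halves ε))
  filter_upwards [h4] with ω hWω (hω : δ ≤ _)
  refine (Set.mem_union ω _ _).2 ?_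
  by_contra hcon
  simp only [Set.mem_ofPred_eq, not_or, not_le] at hcon
  obtain ⟨hc1, hc2⟩ := hcon
  have hz := h3 ω
  -- D is the relative error of the denominator. Off the bad events |D| < 1/2, so Z ≠ 0 and the
  -- formula for W is available.
  set D := (Z₀ n ω)⁻¹ * (Z n ω - Z₀ n ω) with hDdef
  have hZe : Z n ω = Z₀ n ω * (1 + D) := by rw [hDdef]; field_simp; ring
  have hD1 : 1 / 2 < 1 + D := by linarith [(abs_lt.1 hc1).1]
  have hD0 : 1 + D ≠ 0 := by linarith
  have key : N n ω / Z n ω - N₀ n ω / Z₀ n ω =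
      ((Z₀ n ω)⁻¹ * (N n ω - N₀ n ω) + N₀ n ω / Z₀ n ω * -D) / (1 + D) := by
    rw [hZe]; field_simp; ring
  -- The numerator of `key` is below δ/2 and dividing by 1 + D > 1/2 at most doubles it,
  -- contradicting deviation at least δ.
  rw [hWω (by rw [hZe]; exact mul_ne_zero hz hD0), key, abs_div, abs_of_pos (by linarith : 0 < 1 + D), le_div_iff₀ (by linarith)] at hω
  nlinarith

lemma tendsto_charFun_of_negligible_sub (hX : ∀ n, AEMeasurable (X n) (Q n))
    (hY : ∀ n, AEMeasurable (Y n) (Q n)) (h : NegligibleInProb Q fun n ω => X n ω - Y n ω)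
    {t : ℝ} {z : ℂ} (hlim : Tendsto (fun n => charFun ((Q n).map (Y n)) t) atTop (𝓝 z)) :
    Tendsto (fun n => charFun ((Q n).map (X n)) t) atTop (𝓝 z) := by
  have hdiff : Tendsto (fun n => charFun ((Q n).map (X n)) t - charFun ((Q n).map (Y n)) t)
      atTop (𝓝 0) := by
    rw [Metric.tendsto_nhds]
    intro η hη
    -- The good event contributes |t|δ ≤ η/4; the bad one has probability at most η/8 and integrand
    -- at most 2, so another η/4.
    set δ := η / (4 * (|t| + 1)) with hδ
    have hδ0 : 0 < δ := by positivity
    filter_upwards [h δ hδ0 (ENNReal.ofReal (η / 8)) (by simpa using hη)] with n hn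
    rw [dist_zero_right, charFun_apply_real, charFun_apply_real,
      integral_map (hX n) (by fun_prop), integral_map (hY n) (by fun_prop)]
    have hint : ∀ W : Ω n → ℝ, AEMeasurable W (Q n) →
        Integrable (fun ω => Complex.exp (t * W ω * Complex.I)) (Q n) := fun W hW => by
      refine Integrable.of_bound (C := 1) ?_ (ae_of_all _ fun ω => ?_)
      · have : AEMeasurable (fun ω => Complex.exp (t * W ω * Complex.I)) (Q n) := by fun_prop
        exact this.aestronglyMeasurable
      · rw [← Complex.ofReal_mul, Complex.norm_exp_ofReal_mul_I]
    rw [← integral_sub (hint _ (hX n)) (hint _ (hY n))]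
    -- The measurable hull has the same measure and an integrable indicator.
    set A := toMeasurable (Q n) {ω | δ ≤ |X n ω - Y n ω|} with hA
    have hAm : MeasurableSet A := measurableSet_toMeasurable _ _
    have hAQ : (Q n).real A ≤ η / 8 := by
      rw [measureReal_def, hA, measure_toMeasurable]
      exact ENNReal.toReal_le_of_le_ofReal (by positivity) hn
    have hbound : ∀ ω, ‖Complex.exp (t * X n ω * Complex.I) - Complex.exp (t * Y n ω * Complex.I)‖
        ≤ |t| * δ + A.indicator (fun _ => 2) ω := fun ω => by
      rw [← Complex.ofReal_mul, ← Complex.ofReal_mul]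
      by_cases hω : ω ∈ A
      · rw [Set.indicator_of_mem hω]
        refine (norm_sub_le _ _).trans ?_
        rw [Complex.norm_exp_ofReal_mul_I, Complex.norm_exp_ofReal_mul_I]
        have : 0 ≤ |t| * δ := by positivity
        linarith
      · have hlt : |X n ω - Y n ω| < δ := by
          by_contra hcon
          exact hω (subset_toMeasurable _ _ (not_lt.1 hcon))
        rw [Set.indicator_of_notMem hω, add_zero]
        refine (norm_exp_ofReal_mul_I_sub_le _ _).trans ?_
        rw [← mul_sub, abs_mul]
        gcongr
    refine (norm_integral_le_of_norm_le (g := fun ω => |t| * δ + A.indicator (fun _ => 2) ω)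
      ((integrable_const _).add ((integrable_const _).indicator hAm))
      (ae_of_all _ hbound)).trans_lt ?_
    rw [integral_add (integrable_const _) ((integrable_const _).indicator hAm),
      integral_indicator_const _ hAm]
    simp only [integral_const, probReal_univ, smul_eq_mul, one_mul]
    have h1 : |t| * δ ≤ η / 4 := by
      rw [hδ, mul_div_assoc', div_le_iff₀ (by positivity)]
      nlinarith [abs_nonneg t]
    linarith
  simpa using hdiff.add hlim

end InProbability

/-- Telescoping, with both bases in the closed unit disc. -/
lemma norm_pow_sub_pow_le {a b : ℂ} (ha : ‖a‖ ≤ 1) (hb : ‖b‖ ≤ 1) (k : ℕ) :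
    ‖a ^ k - b ^ k‖ ≤ k * ‖a - b‖ := by
  induction k with
  | zero => simp
  | succ k ih =>
    have e : a ^ (k + 1) - b ^ (k + 1) = a ^ k * (a - b) + (a ^ k - b ^ k) * b := by ring
    rw [e]
    refine (norm_add_le _ _).trans ?_
    rw [norm_mul, norm_mul, norm_pow]
    have h1 : ‖a‖ ^ k ≤ 1 := pow_le_one₀ (norm_nonneg _) ha
    have h2 : ‖a‖ ^ k * ‖a - b‖ ≤ 1 * ‖a - b‖ := by gcongr
    have h3 : ‖a ^ k - b ^ k‖ * ‖b‖ ≤ ‖a ^ k - b ^ k‖ * 1 := by gcongr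
    push_cast
    linarith

/-! ### Central limit theorem through characteristic functions. -/

section clt

variable {E : Type*} [MeasurableSpace E] {μ : Measure E} [IsProbabilityMeasure μ] {y : E → ℝ}

lemma charFun_map_sub_isLittleO (hy : MemLp y 2 μ) (hy0 : ∫ z, y z ∂μ = 0) :
    (fun t : ℝ => charFun (μ.map y) t - (1 - ((∫ z, y z ^ 2 ∂μ : ℝ) : ℂ) * t ^ 2 / 2))
      =o[𝓝 0] fun t => t ^ 2 := by
  have hym : AEMeasurable y μ := hy.aestronglyMeasurable.aemeasurable
  have hid : MemLp id 2 (μ.map y) :=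
    (memLp_map_measure_iff aestronglyMeasurable_id hym).2 (by simpa using hy)
  have hP : IsProbabilityMeasure (μ.map y) := Measure.isProbabilityMeasure_map hym
  have h := taylor_isLittleO_univ (x₀ := 0) (contDiff_charFun (μ := μ.map y) (n := 2) hid)
  have e : ∀ t : ℝ, taylorWithinEval (charFun (μ.map y)) 2 Set.univ 0 t =
      1 - ((∫ z, y z ^ 2 ∂μ : ℝ) : ℂ) * t ^ 2 / 2 := fun t => by
    rw [taylorWithinEval_charFun_two_zero hym hid, hy0]
    simp
  simpa only [e, sub_zero] using h

lemma cexp_sub_isLittleO (v : ℝ) :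
    (fun t : ℝ => Complex.exp (-(v * t ^ 2 / 2 : ℝ)) - (1 - (v : ℂ) * t ^ 2 / 2))
      =o[𝓝 0] fun t => t ^ 2 := by
  have h := (Complex.hasDerivAt_exp 0).isLittleO
  have hu : Tendsto (fun t : ℝ => ((-(v * t ^ 2 / 2) : ℝ) : ℂ)) (𝓝 0) (𝓝 0) := by
    have : Continuous fun t : ℝ => ((-(v * t ^ 2 / 2) : ℝ) : ℂ) := by fun_prop
    simpa using this.tendsto 0
  have h2 := h.comp_tendsto hu
  have hO : ((fun x : ℂ => x - 0) ∘ fun t : ℝ => ((-(v * t ^ 2 / 2) : ℝ) : ℂ))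
      =O[𝓝 0] fun t : ℝ => t ^ 2 := by
    refine IsBigO.of_bound (|v| / 2) (Eventually.of_forall fun t => ?_)
    simp only [Function.comp_apply, sub_zero, Complex.norm_real, norm_neg, norm_div, norm_mul,
      Real.norm_eq_abs, norm_pow, Nat.abs_ofNat]
    exact le_of_eq (by ring)
  refine (h2.trans_isBigO hO).congr_left fun t => ?_
  simp only [Function.comp_apply, Complex.exp_zero, smul_eq_mul]
  push_cast
  ring

/-- The characteristic function of y and e^{-vs²/2} agree up to o(s²) at 0, so their k-th powers
differ by k·o(s²) → 0. Comparing with a Gaussian avoids complex logarithms. -/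
lemma tendsto_charFun_pow (hy : MemLp y 2 μ) (hy0 : ∫ z, y z ∂μ = 0) {s : ℕ → ℝ} {k : ℕ → ℕ}
    {τ : ℝ} (hs : Tendsto s atTop (𝓝 0)) (hk : Tendsto (fun n => k n * s n ^ 2) atTop (𝓝 τ)) :
    Tendsto (fun n => charFun (μ.map y) (s n) ^ k n) atTop
      (𝓝 (Complex.exp (-(τ * (∫ z, y z ^ 2 ∂μ) / 2 : ℝ)))) := by
  set v := ∫ z, y z ^ 2 ∂μ with hv
  have hv0 : 0 ≤ v := integral_nonneg fun z => sq_nonneg _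
  have hym : AEMeasurable y μ := hy.aestronglyMeasurable.aemeasurable
  have hP : IsProbabilityMeasure (μ.map y) := Measure.isProbabilityMeasure_map hym
  have ho := ((charFun_map_sub_isLittleO hy hy0).sub (cexp_sub_isLittleO v)).comp_tendsto hs
  have hmain : Tendsto (fun n => Complex.exp (-(v * s n ^ 2 / 2 : ℝ)) ^ k n) atTop
      (𝓝 (Complex.exp (-(τ * v / 2 : ℝ)))) := by
    simp_rw [← Complex.exp_nat_mul]
    refine (Complex.continuous_exp.tendsto _).comp ?_
    have h : Tendsto (fun n => ((-(k n * s n ^ 2 * v / 2) : ℝ) : ℂ)) atTop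
        (𝓝 ((-(τ * v / 2) : ℝ) : ℂ)) :=
      (Complex.continuous_ofReal.tendsto _).comp ((hk.mul_const v).div_const 2).neg
    convert! h using 2 with n
    · push_cast; ring
    · push_cast; ring
  have hdiff : Tendsto (fun n => charFun (μ.map y) (s n) ^ k n -
      Complex.exp (-(v * s n ^ 2 / 2 : ℝ)) ^ k n) atTop (𝓝 0) := by
    have h1 : (fun n => (k n : ℝ) * ‖charFun (μ.map y) (s n) -
        Complex.exp (-(v * s n ^ 2 / 2 : ℝ))‖) =o[atTop] fun n => (k n : ℝ) * s n ^ 2 := by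
      refine (isBigO_refl _ _).mul_isLittleO (ho.norm_left.congr_left fun n => ?_)
      simp [hv]
    have h2 : Tendsto (fun n => (k n : ℝ) * ‖charFun (μ.map y) (s n) -
        Complex.exp (-(v * s n ^ 2 / 2 : ℝ))‖) atTop (𝓝 0) :=
      (isLittleO_one_iff ℝ).1 (h1.trans_isBigO (hk.isBigO_one ℝ))
    refine squeeze_zero_norm (fun n => ?_) h2
    refine norm_pow_sub_pow_le (norm_charFun_le_one _) ?_ _
    rw [← Complex.ofReal_neg, Complex.norm_exp_ofReal, Real.exp_le_one_iff]
    have : 0 ≤ v * s n ^ 2 / 2 := by positivity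
    linarith
  simpa using hdiff.add hmain

lemma charFun_map_sum_pi {ι : Type*} [Fintype ι] (hy : AEMeasurable y μ) (a b t : ℝ) :
    charFun ((Measure.pi fun _ : ι => μ).map fun w => a * (∑ e, y (w e)) + b) t =
      charFun (μ.map y) (t * a) ^ Fintype.card ι * Complex.exp (t * b * Complex.I) := by
  have hsum : AEMeasurable (fun w : ι → E => ∑ e, y (w e)) (Measure.pi fun _ : ι => μ) :=
    Finset.aemeasurable_fun_sum _ fun e _ =>
      hy.comp_quasiMeasurePreserving (Measure.quasiMeasurePreserving_eval _ e)
  rw [charFun_apply_real, integral_map (by fun_prop) (by fun_prop), charFun_apply_real,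
    integral_map hy (by fun_prop),
    ← integral_fintype_prod_eq_pow (fun z => Complex.exp ((t * a : ℝ) * y z * Complex.I)),
    ← integral_mul_const]
  refine integral_congr_ae (ae_of_all _ fun w => ?_)
  simp only
  rw [← Complex.exp_sum, ← Complex.exp_add]
  congr 1
  push_cast
  rw [← Finset.sum_mul, ← Finset.mul_sum]
  ring

end clt

/-! ### Growth rates of |V|, |E|, m and p = m/|E|. -/

section asymptotics

variable {v E m : ℕ → ℝ} {γ : ℝ}

lemma tendsto_atTop_of_sq_isBigO (hv : Tendsto v atTop atTop)
    (hE : (fun n => v n ^ 2) =O[atTop] E) (hE0 : ∀ n, 0 ≤ E n) : Tendsto E atTop atTop := by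
  obtain ⟨K, hK, h⟩ := hE.exists_pos
  have h1 : Tendsto (fun n => v n ^ 2 / K) atTop atTop :=
    ((tendsto_pow_atTop two_ne_zero).comp hv).atTop_div_const hK
  refine tendsto_atTop_mono' _ ?_ h1
  filter_upwards [h.bound] with n hn
  rw [div_le_iff₀ hK, mul_comm]
  simpa [abs_of_nonneg (hE0 n)] using hn

lemma tendsto_mul_div_sq (hE : Tendsto E atTop atTop)
    (hlim : Tendsto (fun n => m n ^ 2 / (2 * E n)) atTop (𝓝 γ)) :
    Tendsto (fun n => E n * (m n / E n) ^ 2) atTop (𝓝 (2 * γ)) := by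
  refine (hlim.const_mul 2).congr' ?_
  filter_upwards [hE.eventually_gt_atTop 0] with n hn
  field_simp

lemma tendsto_div_zero (hE : Tendsto E atTop atTop)
    (hlim : Tendsto (fun n => m n ^ 2 / (2 * E n)) atTop (𝓝 γ)) :
    Tendsto (fun n => m n / E n) atTop (𝓝 0) := by
  have h := (tendsto_mul_div_sq hE hlim).div_atTop hE
  have h2 : Tendsto (fun n => (m n / E n) ^ 2) atTop (𝓝 0) := by
    refine h.congr' ?_
    filter_upwards [hE.eventually_gt_atTop 0] with n hn
    field_simp
  have h3 := (Real.continuous_sqrt.tendsto 0).comp h2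
  simp only [Real.sqrt_zero] at h3
  exact (tendsto_zero_iff_abs_tendsto_zero _).2 (h3.congr fun n => by simp [Real.sqrt_sq_eq_abs])

lemma tendsto_atTop_of_sq_div (hE : Tendsto E atTop atTop) (hγ : 0 < γ) (hm : ∀ n, 0 ≤ m n)
    (hlim : Tendsto (fun n => m n ^ 2 / (2 * E n)) atTop (𝓝 γ)) : Tendsto m atTop atTop := by
  have h := (hlim.pos_mul_atTop hγ (hE.const_mul_atTop (two_pos (α := ℝ))))
  have h2 : Tendsto (fun n => m n ^ 2) atTop atTop := by
    refine h.congr' ?_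
    filter_upwards [hE.eventually_gt_atTop 0] with n hn
    field_simp
  exact (Real.tendsto_sqrt_atTop.comp h2).congr fun n => Real.sqrt_sq (hm n)

/-- Since v⁴ ≤ K²E², the quantity is at most (Ep²)² K²/v, where Ep² converges and v → ∞. -/
lemma tendsto_cube_mul_pow_four (hv : Tendsto v atTop atTop)
    (hvE : (fun n => v n ^ 2) =O[atTop] E) (hE0 : ∀ n, 0 ≤ E n)
    (hlim : Tendsto (fun n => m n ^ 2 / (2 * E n)) atTop (𝓝 γ)) :
    Tendsto (fun n => v n ^ 3 * (m n / E n) ^ 4) atTop (𝓝 0) := by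
  have hE := tendsto_atTop_of_sq_isBigO hv hvE hE0
  obtain ⟨K, hK, h⟩ := hvE.exists_pos
  have h1 : Tendsto (fun n => (E n * (m n / E n) ^ 2) ^ 2 * (K ^ 2 / v n)) atTop (𝓝 0) := by
    simpa using ((tendsto_mul_div_sq hE hlim).pow 2).mul (tendsto_const_nhds.div_atTop hv)
  refine squeeze_zero' ?_ ?_ h1
  · filter_upwards [hv.eventually_gt_atTop 0] with n hn
    positivity
  · filter_upwards [hv.eventually_gt_atTop 0, hE.eventually_gt_atTop 0, h.bound] with n h1 h2 h3
    rw [Real.norm_eq_abs, Real.norm_eq_abs, abs_of_nonneg (by positivity), abs_of_pos h2] at h3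
    have h4 : v n ^ 4 ≤ K ^ 2 * E n ^ 2 := by
      have := pow_le_pow_left₀ (by positivity) h3 2
      calc v n ^ 4 = (v n ^ 2) ^ 2 := by ring
        _ ≤ (K * E n) ^ 2 := this
        _ = _ := by ring
    rw [show (E n * (m n / E n) ^ 2) ^ 2 * (K ^ 2 / v n) =
      (K ^ 2 * E n ^ 2) / v n * (m n / E n) ^ 4 by ring]
    refine mul_le_mul_of_nonneg_right ?_ (by positivity)
    rw [le_div_iff₀ h1]
    calc v n ^ 3 * v n = v n ^ 4 := by ring
      _ ≤ _ := h4

end asymptotics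

/-! ### Comparison with independent edges. -/

/-- The uniform model approximates the independent edge model in mean square over clusters. -/
lemma tendsto_sum_sq_containProb_sub {V : ℕ → Type*} [∀ n, Finite (V n)]
    {G : ∀ n, SimpleGraph (V n)} [∀ n, Fintype (G n).edgeSet]
    (hV : Tendsto (fun n => (Nat.card (V n) : ℝ)) atTop atTop)
    (hE : (fun n => (Nat.card (V n) : ℝ) ^ 2) =O[atTop]
      fun n => (Nat.card (G n).edgeSet : ℝ))
    {S : ∀ n, Finset (Finset (G n).edgeSet)} {m : ℕ → ℕ} {γ : ℝ} (hγ : 0 < γ)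
    (hlim : Tendsto (fun n => (m n : ℝ) ^ 2 / (2 * (Nat.card (G n).edgeSet : ℝ)))
      atTop (𝓝 γ))
    (hp : ∀ᶠ n in atTop, ∀ e, containProb (S n) {e} = m n / Nat.card (G n).edgeSet)
    (hprod : ∃ ρ : ℝ, 0 < ρ ∧ ∀ᶠ n in atTop, ∀ Γ : Finset (G n).edgeSet,
      IsPartialMatching Γ →
        |containProb (S n) Γ / (∏ e ∈ Γ, containProb (S n) {e}) - 1| ≤
          ρ ^ Γ.card / √(m n : ℝ))
    (hnon : ∃ ρ : ℝ, 0 < ρ ∧ ∀ᶠ n in atTop, ∀ Γ : Finset (G n).edgeSet,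
      (∃ π ∈ S n, Γ ⊆ π) → ¬ IsPartialMatching Γ →
        containProb (S n) Γ ≤ ρ ^ Γ.card * ∏ e ∈ Γ, containProb (S n) {e})
    {C : ℝ} (hC : 0 ≤ C) :
    Tendsto (fun n => ∑ Γ, (containProb (S n) Γ -
      ((m n : ℝ) / Nat.card (G n).edgeSet) ^ Γ.card) ^ 2 * C ^ Γ.card) atTop (𝓝 0) := by
  obtain ⟨ρ, hρ, hprod⟩ := hprod
  obtain ⟨ρ', hρ', hnon⟩ := hnon
  -- With R ≥ 1 and R ≥ ρ', both p^k and ρ'^k p^k are at most (Rp)^k, and hence so is the modulus of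
  -- the difference.
  set R := max 1 ρ' with hR
  have hR1 : 1 ≤ R := le_max_left _ _
  have hEinf := tendsto_atTop_of_sq_isBigO hV hE (fun n => Nat.cast_nonneg _)
  have hminf : Tendsto (fun n => (m n : ℝ)) atTop atTop :=
    tendsto_atTop_of_sq_div hEinf hγ (fun n => Nat.cast_nonneg _) hlim
  have hEp := tendsto_mul_div_sq hEinf hlim
  have hV3 := tendsto_cube_mul_pow_four hV hE (fun n => Nat.cast_nonneg _) hlim
  have hb1 := (((Real.continuous_exp.tendsto _).comp (hEp.const_mul (ρ ^ 2 * C)))).div_atTop hminf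
  have hb2 := (hV3.const_mul ((R ^ 2 * C) ^ 2)).mul
    ((Real.continuous_exp.tendsto _).comp (hEp.const_mul (R ^ 2 * C)))
  have hb := hb1.add hb2
  simp only [mul_zero, zero_mul, add_zero] at hb
  refine squeeze_zero' (.of_forall fun n => Finset.sum_nonneg fun Γ _ => by positivity) ?_ hb
  filter_upwards [hp, hprod, hnon, hEinf.eventually_gt_atTop 0, hminf.eventually_gt_atTop 0]
    with n hp hprod hnon hE0 hm0
  set p := (m n : ℝ) / Nat.card (G n).edgeSet with hpdef
  have hp0 : 0 < p := by positivity
  have hpr : ∀ Γ : Finset (G n).edgeSet, ∏ e ∈ Γ, containProb (S n) {e} = p ^ Γ.card := fun Γ => by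
    rw [Finset.prod_congr rfl fun e _ => hp e, Finset.prod_const]
  refine sum_sq_containProb_sub_le (Nat.cast_nonneg _) hC (fun Γ hΓ => ?_) fun Γ hΓ => ?_
  · have h := hprod Γ hΓ
    rw [hpr] at h
    have hpk : 0 < p ^ Γ.card := by positivity
    rw [div_sub_one hpk.ne', abs_div, abs_of_pos hpk, div_le_iff₀ hpk] at h
    linarith
  · have h0 := containProb_nonneg (S n) Γ
    have hpk : p ^ Γ.card ≤ (R * p) ^ Γ.card := by
      gcongr
      exact le_mul_of_one_le_left hp0.le hR1
    have hpk0 : 0 ≤ p ^ Γ.card := by positivity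
    have hup : containProb (S n) Γ ≤ (R * p) ^ Γ.card := by
      -- The assumed bound covers only clusters inside some configuration; all others have
      -- probability 0.
      by_cases hex : ∃ π ∈ S n, Γ ⊆ π
      · refine (hnon Γ hex hΓ).trans ?_
        rw [hpr, ← mul_pow]
        gcongr
        exact le_max_right _ _
      · rw [containProb_eq_zero hex]
        positivity
    rw [abs_le]
    constructor <;> linarith


/-- Equivalent to log(1 + u) ≥ u - u². It dominates ∏ (1 + pX_e)⁻¹ by the exponential of sums that
are bounded in probability. -/
lemma inv_one_add_le_exp {u : ℝ} (hu : -(1 / 2) ≤ u) : (1 + u)⁻¹ ≤ Real.exp (-u + u ^ 2) := by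
  have h1 : 0 < 1 + u := by linarith
  rw [inv_le_iff_one_le_mul₀ h1]
  rcases le_total 0 u with h | h
  · have h2 := Real.add_one_le_exp (-u + u ^ 2)
    calc (1 : ℝ) ≤ (-u + u ^ 2 + 1) * (1 + u) := by nlinarith [pow_nonneg h 3]
      _ ≤ _ := by gcongr
  -- For u < 0 the linear bound only gives 1 + u³ < 1. With the quadratic term the excess over 1 is
  -- u² times the quantity in `h3`.
  · have h2 := Real.quadratic_le_exp_of_nonneg (x := -u + u ^ 2) (by nlinarith)
    have h3 : 0 ≤ u + (1 - u) ^ 2 * (1 + u) / 2 := by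
      obtain ⟨s, rfl⟩ : ∃ s, u = -s := ⟨-u, by ring⟩
      nlinarith [mul_nonneg (neg_nonneg.2 h) (neg_nonneg.2 h), mul_nonneg (mul_nonneg
        (neg_nonneg.2 h) (neg_nonneg.2 h)) (by linarith : 0 ≤ 1 / 2 - s)]
    calc (1 : ℝ) ≤ (1 + (-u + u ^ 2) + (-u + u ^ 2) ^ 2 / 2) * (1 + u) := by
          nlinarith [mul_nonneg (sq_nonneg u) h3]
      _ ≤ _ := by gcongr

/-! ### Moments of i.i.d. sums. -/

section pi

variable {ι : Type*} [Fintype ι] {E : Type*} [MeasurableSpace E] {μ : Measure E}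
  [IsProbabilityMeasure μ] {g : E → ℝ}

lemma memLp_sum_pi {q : ℝ≥0∞} (hg : MemLp g q μ) :
    MemLp (fun w : ι → E => ∑ e, g (w e)) q (Measure.pi fun _ : ι => μ) :=
  memLp_finsetSum _ fun e _ => hg.comp_measurePreserving (measurePreserving_eval _ e)

lemma integrable_sum_pi (hg : Integrable g μ) :
    Integrable (fun w : ι → E => ∑ e, g (w e)) (Measure.pi fun _ : ι => μ) :=
  integrable_finsetSum _ fun _ _ => integrable_comp_eval hg

lemma integral_sum_pi (hg : Integrable g μ) :
    ∫ w : ι → E, ∑ e, g (w e) ∂(Measure.pi fun _ : ι => μ) = Fintype.card ι * ∫ z, g z ∂μ := by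
  rw [integral_finsetSum _ fun e _ => integrable_comp_eval hg]
  simp_rw [fun e => integral_comp_eval (μ := fun _ : ι => μ) (i := e) hg.aestronglyMeasurable]
  simp

lemma integral_sq_sum_pi (hg : MemLp g 2 μ) (hg0 : ∫ z, g z ∂μ = 0) :
    ∫ w : ι → E, (∑ e, g (w e)) ^ 2 ∂(Measure.pi fun _ : ι => μ) =
      Fintype.card ι * ∫ z, g z ^ 2 ∂μ := by
  have h := variance_sum_pi (ι := ι) (μ := fun _ => μ) (X := fun _ => g) fun _ => hg
  have e : (∑ i : ι, fun w : ι → E => g (w i)) = fun w => ∑ i, g (w i) := by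
    ext w; simp
  rw [e, variance_of_integral_eq_zero (memLp_sum_pi hg).aestronglyMeasurable.aemeasurable (by
    rw [integral_sum_pi (hg.integrable (by norm_num)), hg0, mul_zero]),
    variance_of_integral_eq_zero hg.aestronglyMeasurable.aemeasurable hg0] at h
  simpa using h

end pi

/-! ### Linearisation of the cluster quotient. -/

section limit

variable {ι : ℕ → Type*} [∀ n, Fintype (ι n)] {E : Type*} [MeasurableSpace E] {μ : Measure E}
  [IsProbabilityMeasure μ] {x y g : E → ℝ} {p : ℕ → ℝ} {τ : ℝ}

lemma bounded_mul_sum (hg : MemLp g 2 μ) (hg0 : ∫ z, g z ∂μ = 0)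
    (hp2 : Tendsto (fun n => Fintype.card (ι n) * p n ^ 2) atTop (𝓝 τ)) :
    BoundedInProb (fun n => Measure.pi fun _ : ι n => μ) fun n w => p n * ∑ e, g (w e) := by
  have hb := (hp2.mul_const (∫ z, g z ^ 2 ∂μ)).eventually_le_const
    (lt_add_one (τ * ∫ z, g z ^ 2 ∂μ))
  refine .of_integral_sq (M := τ * (∫ z, g z ^ 2 ∂μ) + 1)
    (.of_forall fun n => (memLp_sum_pi hg).const_mul _) (hb.mono fun n hn => ?_)
  simp_rw [mul_pow]
  rw [integral_const_mul, integral_sq_sum_pi hg hg0]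
  linarith

lemma bounded_sq_mul_sum (hg : Integrable g μ)
    (hp2 : Tendsto (fun n => Fintype.card (ι n) * p n ^ 2) atTop (𝓝 τ)) :
    BoundedInProb (fun n => Measure.pi fun _ : ι n => μ) fun n w => p n ^ 2 * ∑ e, g (w e) := by
  have hb := (hp2.mul_const (∫ z, |g z| ∂μ)).eventually_le_const
    (lt_add_one (τ * ∫ z, |g z| ∂μ))
  refine .of_integral (M := τ * (∫ z, |g z| ∂μ) + 1)
    (.of_forall fun n => (integrable_sum_pi hg).const_mul _)
    (hb.mono fun n hn => ?_)
  calc ∫ w : ι n → E, |p n ^ 2 * ∑ e, g (w e)| ∂(Measure.pi fun _ : ι n => μ)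
      ≤ ∫ w : ι n → E, p n ^ 2 * ∑ e, |g (w e)| ∂(Measure.pi fun _ : ι n => μ) := by
        refine integral_mono ((integrable_sum_pi hg).const_mul _).abs
          ((integrable_sum_pi hg.abs).const_mul _) fun w => ?_
        simp only
        rw [abs_mul, abs_of_nonneg (sq_nonneg _)]
        gcongr
        exact Finset.abs_sum_le_sum_abs _ _
    _ ≤ _ := by
        rw [integral_const_mul, integral_sum_pi hg.abs]
        linarith

lemma negligible_cube_mul_sum (hg : Integrable g μ) (hp : Tendsto p atTop (𝓝 0))
    (hp2 : Tendsto (fun n => Fintype.card (ι n) * p n ^ 2) atTop (𝓝 τ)) :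
    NegligibleInProb (fun n => Measure.pi fun _ : ι n => μ)
      fun n w => p n * (p n ^ 2 * ∑ e, g (w e)) := by
  have hb : NegligibleInProb (fun n => Measure.pi fun _ : ι n => μ) fun n _ => p n := by
    refine .of_integral (.of_forall fun n => integrable_const _) ?_
    simpa using hp.abs
  refine ((bounded_sq_mul_sum hg hp2).mul_negligible hb).mono (.of_forall fun n w => ?_)
  rw [mul_comm]

/-- Weak law of large numbers: the centred sum has variance p²·(card·p²)·Var g → 0, and card·p² → τ
handles the mean. -/
lemma negligible_sq_mul_sum_sub (hg : MemLp g 2 μ) (hp : Tendsto p atTop (𝓝 0))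
    (hp2 : Tendsto (fun n => Fintype.card (ι n) * p n ^ 2) atTop (𝓝 τ)) :
    NegligibleInProb (fun n => Measure.pi fun _ : ι n => μ)
      fun n w => p n ^ 2 * (∑ e, g (w e)) - τ * ∫ z, g z ∂μ := by
  set a := ∫ z, g z ∂μ with ha
  have hg' : MemLp (fun z => g z - a) 2 μ := hg.sub (memLp_const a)
  have hg0 : ∫ z, (g z - a) ∂μ = 0 := by
    rw [integral_sub (hg.integrable (by norm_num)) (integrable_const _)]
    simp [ha]
  have h1 : NegligibleInProb (fun n => Measure.pi fun _ : ι n => μ)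
      fun n w => p n ^ 2 * ∑ e, (g (w e) - a) := by
    refine .of_integral_sq (.of_forall fun n => (memLp_sum_pi hg').const_mul _) ?_
    have hb := ((hp.pow 2).mul hp2).mul_const (∫ z, (g z - a) ^ 2 ∂μ)
    simp only [ne_eq, OfNat.ofNat_ne_zero, not_false_eq_true, zero_pow, zero_mul] at hb
    refine hb.congr fun n => ?_
    simp_rw [mul_pow]
    rw [integral_const_mul, integral_sq_sum_pi hg' hg0]
    ring
  have h2 : NegligibleInProb (fun n => Measure.pi fun _ : ι n => μ)
      fun n _ => (Fintype.card (ι n) * p n ^ 2 - τ) * a := by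
    refine .of_integral (.of_forall fun n => integrable_const _) ?_
    have := ((hp2.sub_const τ).mul_const a).abs
    simpa using this
  refine (h1.add h2).mono (.of_forall fun n w => le_of_eq ?_)
  congr 1
  rw [Finset.sum_sub_distrib, Finset.sum_const, nsmul_eq_mul, Finset.card_univ]
  ring

variable [∀ n, DecidableEq (ι n)]

omit [∀ n, DecidableEq (ι n)] in
lemma negligible_cluster_sum_sub {u : ∀ n, Finset (ι n) → (ι n → E) → ℝ} {C : ℝ}
    (hu : ∀ n, IsClusterFamily (u n) μ C) {a b : ∀ n, Finset (ι n) → ℝ}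
    (h : Tendsto (fun n => ∑ Δ, (a n Δ - b n Δ) ^ 2 * C ^ Δ.card) atTop (𝓝 0)) :
    NegligibleInProb (fun n => Measure.pi fun _ : ι n => μ)
      fun n w => ∑ Δ, a n Δ * u n Δ w - ∑ Δ, b n Δ * u n Δ w := by
  simp_rw [← Finset.sum_sub_distrib, ← sub_mul]
  refine .of_integral_sq (.of_forall fun n => (hu n).memLp_sum _) ?_
  exact squeeze_zero (fun n => integral_nonneg fun w => sq_nonneg _)
    (fun n => (hu n).integral_sq_sum_le _) h

/-- The logarithmic derivative of the cluster expansion is asymptotically linear. -/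
lemma negligible_cluster_quotient_sub (hx : MemLp x 4 μ) (hy : MemLp y 4 μ)
    (hx0 : ∫ z, x z ∂μ = 0) (hy0 : ∫ z, y z ∂μ = 0) (hx1 : ∀ z, -1 ≤ x z)
    (hp0 : ∀ n, 0 ≤ p n) (hp : Tendsto p atTop (𝓝 0))
    (hp2 : Tendsto (fun n => Fintype.card (ι n) * p n ^ 2) atTop (𝓝 τ))
    {a : ∀ n, Finset (ι n) → ℝ}
    (ha : ∀ C : ℝ, 0 ≤ C →
      Tendsto (fun n => ∑ Δ, (a n Δ - p n ^ Δ.card) ^ 2 * C ^ Δ.card) atTop (𝓝 0))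
    {W : ∀ n, (ι n → E) → ℝ}
    (hW : ∀ᶠ n in atTop, ∀ᵐ w ∂(Measure.pi fun _ : ι n => μ),
      ∑ Δ, a n Δ * ∏ e ∈ Δ, x (w e) ≠ 0 →
        W n w = (∑ Δ, a n Δ * prodDeriv (fun e => x (w e)) (fun e => y (w e)) Δ) /
          ∑ Δ, a n Δ * ∏ e ∈ Δ, x (w e)) :
    NegligibleInProb (fun n => Measure.pi fun _ : ι n => μ) fun n w =>
      W n w - (p n * ∑ e, y (w e) - τ * ∫ z, x z * y z ∂μ) := by
  have hx2 : MemLp x 2 μ := hx.mono_exponent (by norm_num)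
  have hy2 : MemLp y 2 μ := hy.mono_exponent (by norm_num)
  have htri : ENNReal.HolderTriple 4 4 2 := ⟨by
    rw [← two_mul, show (4 : ℝ≥0∞) = 2 * 2 by norm_num,
      ENNReal.mul_inv (by norm_num) (by norm_num), ← mul_assoc,
      ENNReal.mul_inv_cancel (by norm_num) (by norm_num), one_mul]⟩
  have hxy : MemLp (fun z => x z * y z) 2 μ := hy.mul hx
  have hxxy : Integrable (fun z => x z * (x z * y z)) μ := hx2.integrable_mul hxy
  have hX : 0 ≤ ∫ z, x z ^ 2 ∂μ := integral_nonneg fun z => sq_nonneg _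
  have hY : 0 ≤ ∫ z, y z ^ 2 ∂μ := integral_nonneg fun z => sq_nonneg _
  -- Replace the coefficients by p^|Δ| in numerator and denominator; `eN` and `eZ` then resum both
  -- in closed product form.
  have hN := negligible_cluster_sum_sub (fun n => isClusterFamily_prodDeriv (ι := ι n) hx2 hy2 hx0 hy0)
    (ha _ (by positivity))
  have hZ := negligible_cluster_sum_sub (fun n => isClusterFamily_prod (ι := ι n) hx2 hx0)
    (ha _ (by positivity))
  have eN : ∀ n (w : ι n → E),
      ∑ Δ, p n ^ Δ.card * prodDeriv (fun e => x (w e)) (fun e => y (w e)) Δ =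
      prodDeriv (fun e => 1 + p n * x (w e)) (fun e => p n * y (w e)) Finset.univ := fun n w => by
    rw [← sum_powerset_prodDeriv, Finset.powerset_univ]
    exact Finset.sum_congr rfl fun Δ _ => (prodDeriv_const_mul _ _ _ _).symm
  have eZ : ∀ n (w : ι n → E), ∑ Δ, p n ^ Δ.card * ∏ e ∈ Δ, x (w e) =
      ∏ e, (1 + p n * x (w e)) := fun n w => by
    rw [Finset.prod_one_add, Finset.powerset_univ]
    exact Finset.sum_congr rfl fun Δ _ => by rw [Finset.prod_mul_distrib, Finset.prod_const]
  simp_rw [eN] at hN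
  simp_rw [eZ] at hZ
  -- Only x ≥ -1 and p ≤ 1/2 are needed, so the bound is uniform although x is unbounded above.
  have hsmall : ∀ᶠ n in atTop, ∀ z, -(1 / 2) ≤ p n * x z := by
    filter_upwards [hp.eventually_le_const (by norm_num : (0 : ℝ) < 1 / 2)] with n hn z
    nlinarith [hx1 z, hp0 n]
  have hpos : ∀ᶠ n in atTop, ∀ z, 0 < 1 + p n * x z := by
    filter_upwards [hsmall] with n hn z
    linarith [hn z]
  have hZ0 : ∀ᶠ n in atTop, ∀ w : ι n → E, ∏ e, (1 + p n * x (w e)) ≠ 0 := by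
    filter_upwards [hpos] with n hn w
    exact Finset.prod_ne_zero_iff.2 fun e _ => (hn _).ne'
  have hinv : BoundedInProb (fun n => Measure.pi fun _ : ι n => μ)
      fun n w => (∏ e, (1 + p n * x (w e)))⁻¹ := by
    have h1 := (((bounded_mul_sum (ι := ι) hx2 hx0 hp2).mono (X := fun n w => -(p n * ∑ e, x (w e)))
      (.of_forall fun n w => (abs_neg _).le)).add
        (bounded_sq_mul_sum (ι := ι) hx2.integrable_sq hp2)).exp
    refine h1.mono ?_
    filter_upwards [hsmall, hpos] with n hn hn' w
    rw [abs_of_pos (inv_pos.2 (Finset.prod_pos fun e _ => hn' _)), abs_of_pos (Real.exp_pos _),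
      ← Finset.prod_inv_distrib]
    have e1 : -(p n * ∑ e, x (w e)) + p n ^ 2 * ∑ e, x (w e) ^ 2 =
        ∑ e, (-(p n * x (w e)) + (p n * x (w e)) ^ 2) := by
      simp_rw [mul_pow, Finset.sum_add_distrib, Finset.sum_neg_distrib, Finset.mul_sum]
    rw [e1, Real.exp_sum]
    exact Finset.prod_le_prod (fun e _ => (inv_pos.2 (hn' _)).le)
      fun e _ => inv_one_add_le_exp (hn _)
  -- Expand py/(1 + px) = py - p²xy + p³x²y/(1 + px). The denominator is at least 1/2, which
  -- explains the 2 in `h2`.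
  have hlin : NegligibleInProb (fun n => Measure.pi fun _ : ι n => μ) fun n w =>
      prodDeriv (fun e => 1 + p n * x (w e)) (fun e => p n * y (w e)) Finset.univ /
        (∏ e, (1 + p n * x (w e))) - (p n * ∑ e, y (w e) - τ * ∫ z, x z * y z ∂μ) := by
    have h1 := negligible_sq_mul_sum_sub (ι := ι) hxy hp hp2
    have h2 := negligible_cube_mul_sum (ι := ι) (hxxy.abs.const_mul 2) hp hp2
    have h3 : NegligibleInProb (fun n => Measure.pi fun _ : ι n => μ) fun n w =>
        ∑ e, p n ^ 3 * (x (w e) * (x (w e) * y (w e)) / (1 + p n * x (w e))) := by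
      refine h2.mono ?_
      filter_upwards [hsmall] with n hn w
      have hp3 : 0 ≤ p n ^ 3 := pow_nonneg (hp0 n) 3
      have hr : p n * (p n ^ 2 * ∑ e, 2 * |x (w e) * (x (w e) * y (w e))|) =
          ∑ e, p n ^ 3 * (2 * |x (w e) * (x (w e) * y (w e))|) := by
        rw [Finset.mul_sum, Finset.mul_sum]
        exact Finset.sum_congr rfl fun e _ => by ring
      rw [hr]
      refine le_trans ?_ (le_abs_self _)
      refine (Finset.abs_sum_le_sum_abs _ _).trans (Finset.sum_le_sum fun e _ => ?_)
      have h4 := hn (w e)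
      have h5 : 0 < 1 + p n * x (w e) := by linarith
      rw [abs_mul, abs_of_nonneg hp3, abs_div, abs_of_pos h5]
      gcongr
      rw [div_le_iff₀ h5]
      nlinarith [abs_nonneg (x (w e) * (x (w e) * y (w e)))]
    have h4 := h3.add h1.neg
    refine h4.mono ?_
    filter_upwards [hpos] with n hn w
    refine le_of_eq ?_
    congr 1
    rw [prodDeriv_eq_prod_mul_sum _ _ _ fun e _ => (hn _).ne',
      mul_div_cancel_left₀ _ (Finset.prod_ne_zero_iff.2 fun e _ => (hn _).ne')]
    have h6 : ∀ e, p n * y (w e) / (1 + p n * x (w e)) = p n * y (w e) -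
        p n ^ 2 * (x (w e) * y (w e)) +
        p n ^ 3 * (x (w e) * (x (w e) * y (w e)) / (1 + p n * x (w e))) := fun e => by
      have := (hn (w e)).ne'
      field_simp
      ring
    rw [Finset.sum_congr rfl fun e _ => h6 e, Finset.sum_add_distrib, Finset.sum_sub_distrib,
      ← Finset.mul_sum, ← Finset.mul_sum (f := fun e => x (w e) * y (w e))]
    ring
  have hconst : BoundedInProb (fun n => Measure.pi fun _ : ι n => μ)
      fun n _ => -(τ * ∫ z, x z * y z ∂μ) :=
    .of_integral (.of_forall fun n => integrable_const _) (M := |τ * ∫ z, x z * y z ∂μ|)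
      (.of_forall fun n => by simp)
  -- The quotient is bounded in probability because its linear approximation is.
  have hquot : BoundedInProb (fun n => Measure.pi fun _ : ι n => μ) fun n w =>
      prodDeriv (fun e => 1 + p n * x (w e)) (fun e => p n * y (w e)) Finset.univ /
        (∏ e, (1 + p n * x (w e))) := by
    refine (hlin.bounded.add ((bounded_mul_sum (ι := ι) hy2 hy0 hp2).add hconst)).mono
      (.of_forall fun n w => le_of_eq ?_)
    congr 1
    ring
  refine ((negligible_div_sub_div hN hZ hZ0 hinv hquot hW).add hlin).mono
    (.of_forall fun n w => le_of_eq ?_)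
  congr 1
  ring

end limit

/-! ### From the Gibbs average to cluster sums. -/

section weights

lemma expMoment_zero_add {β : ℝ} (hβ : 0 < β) {a b : EReal} (ha : a ≠ ⊥) (hb : b ≠ ⊥) :
    expMoment β 0 (a + b) = expMoment β 0 a * expMoment β 0 b := by
  induction a with
  | bot => exact absurd rfl ha
  | top => simp [EReal.top_add_of_ne_bot hb, expMoment_top hβ]
  | coe r =>
    induction b with
    | bot => exact absurd rfl hb
    | top => simp [EReal.add_top_of_ne_bot ha, expMoment_top hβ]
    | coe s =>
      rw [← EReal.coe_add]
      simp only [expMoment_coe]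
      rw [mul_add, Real.exp_add]
      ring

lemma expMoment_one_add {β : ℝ} (hβ : 0 < β) {a b : EReal} (ha : a ≠ ⊥) (hb : b ≠ ⊥) :
    expMoment β 1 (a + b) =
      expMoment β 1 a * expMoment β 0 b + expMoment β 0 a * expMoment β 1 b := by
  induction a with
  | bot => exact absurd rfl ha
  | top => simp [EReal.top_add_of_ne_bot hb, expMoment_top hβ]
  | coe r =>
    induction b with
    | bot => exact absurd rfl hb
    | top => simp [EReal.add_top_of_ne_bot ha, expMoment_top hβ]
    | coe s =>
      rw [← EReal.coe_add]
      simp only [expMoment_coe]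
      rw [mul_add, Real.exp_add]
      ring

variable {α : Type*} {w : α → EReal}

lemma weight_ne_bot (hw : ∀ e, w e ≠ ⊥) (π : Finset α) : weight w π ≠ ⊥ := by
  classical
  induction π using Finset.induction_on with
  | empty => simp [weight]
  | insert a s ha ih =>
    rw [weight, Finset.sum_insert ha, Ne, EReal.add_eq_bot_iff, not_or]
    exact ⟨hw a, ih⟩

lemma expMoment_zero_weight {β : ℝ} (hβ : 0 < β) (hw : ∀ e, w e ≠ ⊥) (π : Finset α) :
    expMoment β 0 (weight w π) = ∏ e ∈ π, expMoment β 0 (w e) := by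
  classical
  induction π using Finset.induction_on with
  | empty => simp [weight, expMoment, expNeg]
  | insert a s ha ih =>
    rw [weight, Finset.sum_insert ha, ← weight,
      expMoment_zero_add hβ (hw a) (weight_ne_bot hw s), Finset.prod_insert ha, ← ih]

/-- W e^{-βW} is minus the β-derivative of ∏ e^{-βω_e}, so the Leibniz rule applies. -/
lemma expMoment_one_weight [DecidableEq α] {β : ℝ} (hβ : 0 < β) (hw : ∀ e, w e ≠ ⊥)
    (π : Finset α) : expMoment β 1 (weight w π) =
      prodDeriv (fun e => expMoment β 0 (w e)) (fun e => expMoment β 1 (w e)) π := by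
  induction π using Finset.induction_on with
  | empty => simp [weight, expMoment, prodDeriv]
  | insert a s ha ih =>
    rw [weight, Finset.sum_insert ha, ← weight, prodDeriv_insert _ _ ha, ← ih,
      ← expMoment_zero_weight hβ hw,
      expMoment_one_add hβ (hw a) (weight_ne_bot hw s)]

/-- The normalisations cancel. If Z vanishes, both sides are 0 by the convention for division. -/
lemma gibbsAverage_eq (S : Finset (Finset α)) (w : α → EReal) (β : ℝ) :
    gibbsAverage S w β =
      (∑ π ∈ S, expMoment β 1 (weight w π)) / ∑ π ∈ S, expMoment β 0 (weight w π) := by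
  rcases S.eq_empty_or_nonempty with rfl | hS
  · simp [gibbsAverage]
  have hS' : (S.card : ℝ) ≠ 0 := by exact_mod_cast hS.card_ne_zero
  simp only [gibbsAverage, gibbsProb, partitionFunction, expMoment, pow_zero, one_mul, pow_one]
  rw [Finset.sum_div]
  refine Finset.sum_congr rfl fun π _ => ?_
  field_simp

lemma measurable_gibbsAverage (S : Finset (Finset α)) (β : ℝ) :
    Measurable fun w : α → EReal => gibbsAverage S w β := by
  have hw : ∀ π : Finset α, Measurable fun w : α → EReal => weight w π := fun π =>
    Finset.measurable_fun_sum _ fun e _ => measurable_pi_apply e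
  simp_rw [gibbsAverage_eq]
  have h : ∀ j, Measurable fun w : α → EReal => ∑ π ∈ S, expMoment β j (weight w π) := fun j =>
    Finset.measurable_fun_sum _ fun π _ => (measurable_expMoment β j).comp (hw π)
  exact (h 1).div (h 0)

/-- In the direction f itself the derivative of ∏ f is |π| ∏ f. With |π| = m and c = ψ'(β) this
produces the centring m ψ'(β). -/
lemma prodDeriv_add_const_mul_self [DecidableEq α] (f g : α → ℝ) (c : ℝ) (π : Finset α) :
    prodDeriv f (fun e => -(g e + c * f e)) π =
      -(prodDeriv f g π + c * π.card * ∏ e ∈ π, f e) := by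
  simp only [prodDeriv]
  have h : ∀ e ∈ π, -(g e + c * f e) * ∏ e' ∈ π.erase e, f e' =
      -(g e * ∏ e' ∈ π.erase e, f e') - c * ∏ e' ∈ π, f e' := fun e he => by
    rw [← Finset.mul_prod_erase π f he]; ring
  rw [Finset.sum_congr rfl h, Finset.sum_sub_distrib, Finset.sum_neg_distrib, Finset.sum_const,
    nsmul_eq_mul]
  ring

variable {μ : Measure EReal} {β : ℝ}

/-- The centred Gibbs average is the logarithmic derivative of the cluster expansion. -/
lemma gibbsAverage_add_eq [Fintype α] [DecidableEq α] {S : Finset (Finset α)} {m : ℕ}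
    (hm : ∀ π ∈ S, π.card = m) (hβ : 0 < β)
    (hw : ∀ e, w e ≠ ⊥)
    (hZ : ∑ Δ, containProb S Δ * ∏ e ∈ Δ, siteX μ β (w e) ≠ 0) :
    -(gibbsAverage S w β + m * deriv (psi μ) β) =
      (∑ Δ, containProb S Δ *
        prodDeriv (fun e => siteX μ β (w e)) (fun e => siteY μ β (w e)) Δ) /
      ∑ Δ, containProb S Δ * ∏ e ∈ Δ, siteX μ β (w e) := by
  set L := ∫ z, expMoment β 0 z ∂μ with hLdef
  set D := deriv (psi μ) β with hD
  have hx : ∀ e, 1 + siteX μ β (w e) = L⁻¹ * expMoment β 0 (w e) := fun e => by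
    simp only [siteX, ← hLdef]; ring
  have hy : ∀ e, siteY μ β (w e) =
      L⁻¹ * -(expMoment β 1 (w e) + D * expMoment β 0 (w e)) := fun e => by
    simp only [siteY, ← hLdef, ← hD]; ring
  have eZ : ∑ Δ, containProb S Δ * ∏ e ∈ Δ, siteX μ β (w e) =
      (1 / (S.card : ℝ)) * (L⁻¹ ^ m * ∑ π ∈ S, expMoment β 0 (weight w π)) := by
    rw [← sum_powerset_div_card S (fun Δ => ∏ e ∈ Δ, siteX μ β (w e)), Finset.mul_sum _ _ (L⁻¹ ^ m)]
    congr 1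
    refine Finset.sum_congr rfl fun π hπ => ?_
    rw [← Finset.prod_one_add, Finset.prod_congr rfl fun e _ => hx e, Finset.prod_mul_distrib,
      Finset.prod_const, hm π hπ, expMoment_zero_weight hβ hw]
  have eN : ∑ Δ, containProb S Δ *
        prodDeriv (fun e => siteX μ β (w e)) (fun e => siteY μ β (w e)) Δ =
      (1 / (S.card : ℝ)) * (L⁻¹ ^ m * -(∑ π ∈ S, expMoment β 1 (weight w π) +
        D * m * ∑ π ∈ S, expMoment β 0 (weight w π))) := by
    rw [← sum_powerset_div_card S, Finset.mul_sum _ _ (D * m), ← Finset.sum_add_distrib,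
      ← Finset.sum_neg_distrib, Finset.mul_sum _ _ (L⁻¹ ^ m)]
    congr 1
    refine Finset.sum_congr rfl fun π hπ => ?_
    rw [sum_powerset_prodDeriv]
    simp_rw [hx, hy]
    rw [prodDeriv_const_mul, prodDeriv_add_const_mul_self, hm π hπ, expMoment_zero_weight hβ hw,
      expMoment_one_weight hβ hw]
  rw [eZ] at hZ
  rw [eN, eZ, gibbsAverage_eq]
  -- The nonvanishing cluster sum supplies all the nonzero factors: 1/|S|, L^{-m} and the sum of
  -- Gibbs weights.
  have h1 : (1 / (S.card : ℝ)) ≠ 0 := left_ne_zero_of_mul hZ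
  have h2 := right_ne_zero_of_mul hZ
  rw [mul_div_mul_left _ _ h1, mul_div_mul_left _ _ (left_ne_zero_of_mul h2)]
  have h3 := right_ne_zero_of_mul h2
  field_simp

end weights
end GibbsCLT

/-! ### Assembly of the limit theorem. -/

theorem theorem2p9
    -- The graphs: edge-transitive, with `|V_n| = c n` and `|E_n| = Θ(|V_n|²)`.
    (V : ℕ → Type*) [∀ n, Finite (V n)] (G : ∀ n, SimpleGraph (V n))
    (hG : ∀ᶠ n in atTop, GibbsCLT.IsEdgeTransitive (G n))
    (c : ℕ) (hc : 0 < c) (hV : ∀ᶠ n in atTop, Nat.card (V n) = c * n)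
    (hE : (fun n => (Nat.card (G n).edgeSet : ℝ)) =Θ[atTop]
      fun n => (Nat.card (V n) : ℝ) ^ 2)
    -- The configurations: spanning subgraphs, given by their edge sets, with `m` edges each.
    (S : ∀ n, Finset (Finset (G n).edgeSet)) (m : ℕ → ℕ)
    (hm : ∀ᶠ n in atTop, ∀ π ∈ S n, π.card = m n)
    (γ : ℝ) (hγ : 0 < γ)
    (hlim : Tendsto (fun n => (m n : ℝ) ^ 2 / (2 * (Nat.card (G n).edgeSet : ℝ)))
      atTop (𝓝 γ))
    -- Every partial matching extends to a configuration.
    (hext : ∀ᶠ n in atTop, ∀ Γ : Finset (G n).edgeSet, GibbsCLT.IsPartialMatching Γ →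
      ∃ π ∈ S n, Γ ⊆ π)
    -- The probability `ℙ(e ∈ π)` is the same for all edges `e`.
    (hedge : ∀ᶠ n in atTop, ∀ e f : (G n).edgeSet,
      GibbsCLT.containProb (S n) {e} = GibbsCLT.containProb (S n) {f})
    -- Approximate independence along partial matchings.
    (hprod : ∃ ρ : ℝ, 0 < ρ ∧ ∀ᶠ n in atTop, ∀ Γ : Finset (G n).edgeSet,
      GibbsCLT.IsPartialMatching Γ →
        |GibbsCLT.containProb (S n) Γ / (∏ e ∈ Γ, GibbsCLT.containProb (S n) {e}) - 1| ≤
          ρ ^ Γ.card / √(m n : ℝ))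
    -- Upper bound for subgraphs of configurations that are not partial matchings.
    (hnon : ∃ ρ : ℝ, 0 < ρ ∧ ∀ᶠ n in atTop, ∀ Γ : Finset (G n).edgeSet,
      (∃ π ∈ S n, Γ ⊆ π) → ¬ GibbsCLT.IsPartialMatching Γ →
        GibbsCLT.containProb (S n) Γ ≤
          ρ ^ Γ.card * ∏ e ∈ Γ, GibbsCLT.containProb (S n) {e})
    -- The common law of the weights, on `(-∞, +∞]`, with `𝔼 e^{-βω} < ∞` for all `β > 0`
    -- (which forces `ω > -∞` almost surely).
    (μ : Measure EReal) [IsProbabilityMeasure μ] (hμ : μ {⊤} ≠ 1)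
    (hψ : ∀ b : ℝ, 0 < b → GibbsCLT.laplace μ b < ∞)
    -- The i.i.d. weights on the edges of `G_n`.
    (Ω : ℕ → Type*) [∀ n, MeasurableSpace (Ω n)] (P : ∀ n, Measure (Ω n))
    [∀ n, IsProbabilityMeasure (P n)]
    (w : ∀ n, (G n).edgeSet → Ω n → EReal)
    (hlaw : ∀ n e, HasLaw (w n e) μ (P n))
    (hindep : ∀ n, iIndepFun (w n) (P n))
    (β : ℝ) (hβ : 0 < β) :
    TendstoInDistribution
      (fun n ω => GibbsCLT.gibbsAverage (S n) (fun e => w n e ω) β +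
        (m n : ℝ) * deriv (GibbsCLT.psi μ) β)
      atTop (id : ℝ → ℝ) P
      (gaussianReal (GibbsCLT.limitMean μ γ β) (GibbsCLT.limitVar μ γ β).toNNReal) := by
  classical
  have hfin : ∀ n, Fintype (G n).edgeSet := fun n => Fintype.ofFinite _
  have hVinf : Tendsto (fun n => (Nat.card (V n) : ℝ)) atTop atTop := by
    have h : Tendsto (fun n : ℕ => (c : ℝ) * n) atTop atTop :=
      tendsto_natCast_atTop_atTop.const_mul_atTop (by exact_mod_cast hc)
    refine h.congr' ?_
    filter_upwards [hV] with n hn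
    rw [hn]; push_cast; ring
  have hEinf := GibbsCLT.tendsto_atTop_of_sq_isBigO hVinf hE.isBigO_symm
    fun n => Nat.cast_nonneg _
  have hp : ∀ᶠ n in atTop, ∀ e, GibbsCLT.containProb (S n) {e} =
      m n / Nat.card (G n).edgeSet := by
    filter_upwards [hm, hext, hedge] with n hm hext hedge e
    -- The empty matching extends to a configuration, so `S n` is nonempty.
    obtain ⟨π, hπ, -⟩ := hext ∅ (by simp [GibbsCLT.IsPartialMatching])
    exact GibbsCLT.containProb_singleton_eq ⟨π, hπ⟩ hm hedge e
  have hp2 := GibbsCLT.tendsto_mul_div_sq hEinf hlim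
  have hp0 := GibbsCLT.tendsto_div_zero hEinf hlim
  have hmain := GibbsCLT.negligible_cluster_quotient_sub (ι := fun n => (G n).edgeSet)
    (p := fun n => (m n : ℝ) / Nat.card (G n).edgeSet) (τ := 2 * γ)
    (a := fun n => GibbsCLT.containProb (S n))
    (W := fun n w => -(GibbsCLT.gibbsAverage (S n) w β + m n * deriv (GibbsCLT.psi μ) β))
    (GibbsCLT.memLp_siteX hψ hβ) (GibbsCLT.memLp_siteY hψ hβ)
    (GibbsCLT.integral_siteX hμ hψ hβ) (GibbsCLT.integral_siteY hμ hψ hβ)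
    (GibbsCLT.neg_one_le_siteX β) (fun n => by positivity) hp0
    (by simpa only [Nat.card_eq_fintype_card] using hp2)
    (fun C hC => GibbsCLT.tendsto_sum_sq_containProb_sub hVinf hE.isBigO_symm hγ hlim hp hprod
      hnon hC)
    (by
      filter_upwards [hm] with n hm
      have hae : ∀ᵐ w ∂(Measure.pi fun _ : (G n).edgeSet => μ), ∀ e, w e ≠ ⊥ :=
        ae_all_iff.2 fun e =>
          (Measure.quasiMeasurePreserving_eval (fun _ => μ) e).ae (GibbsCLT.ae_ne_bot hψ)
      filter_upwards [hae] with w hw hZ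
      exact GibbsCLT.gibbsAverage_add_eq hm hβ hw hZ)
  rw [GibbsCLT.integral_siteX_mul_siteY hμ hψ hβ, ← mul_assoc] at hmain
  have hmeas : ∀ n, Measurable fun w : (G n).edgeSet → EReal =>
      GibbsCLT.gibbsAverage (S n) w β + m n * deriv (GibbsCLT.psi μ) β := fun n =>
    (GibbsCLT.measurable_gibbsAverage (S n) β).add_const _
  have hpi : ∀ n, HasLaw (fun ω e => w n e ω) (Measure.pi fun _ : (G n).edgeSet => μ) (P n) :=
    fun n => (hindep n).hasLaw_pi (hlaw n)
  have hX : ∀ n, AEMeasurable (fun ω => GibbsCLT.gibbsAverage (S n) (fun e => w n e ω) β +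
      m n * deriv (GibbsCLT.psi μ) β) (P n) := fun n =>
    (hmeas n).comp_aemeasurable (hpi n).aemeasurable
  -- The variance is 2γ 𝔼Y², so `Real.toNNReal` does not truncate it.
  have hvar : 0 ≤ GibbsCLT.limitVar μ γ β := by
    rw [GibbsCLT.limitVar, mul_assoc, ← GibbsCLT.integral_siteY_sq hμ hψ hβ]
    have : 0 ≤ ∫ z, GibbsCLT.siteY μ β z ^ 2 ∂μ := integral_nonneg fun z => sq_nonneg _
    positivity
  refine ⟨hX, by fun_prop, ?_⟩
  refine ProbabilityMeasure.tendsto_iff_tendsto_charFun.2 fun t => ?_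
  simp only [ProbabilityMeasure.coe_mk, Measure.map_id, charFun_gaussianReal,
    Real.coe_toNNReal _ hvar]
  -- Only the joint law of the weights matters, so everything moves to the product space.
  have hmap : ∀ n, (P n).map (fun ω => GibbsCLT.gibbsAverage (S n) (fun e => w n e ω) β +
      m n * deriv (GibbsCLT.psi μ) β) = (Measure.pi fun _ : (G n).edgeSet => μ).map fun w =>
        GibbsCLT.gibbsAverage (S n) w β + m n * deriv (GibbsCLT.psi μ) β := fun n => by
    rw [← (hpi n).map_eq, AEMeasurable.map_map_of_aemeasurable (hmeas n).aemeasurable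
      (hpi n).aemeasurable]
    rfl
  simp_rw [hmap]
  -- `hmain` concerns minus the centred average. Changing sign gives -p ∑ Y_e + 2γ 𝔼[XY], whose
  -- constant is the limiting mean.
  refine GibbsCLT.tendsto_charFun_of_negligible_sub (Q := fun n =>
    Measure.pi fun _ : (G n).edgeSet => μ)
    (Y := fun n w => -((m n : ℝ) / Nat.card (G n).edgeSet) *
      (∑ e, GibbsCLT.siteY μ β (w e)) + GibbsCLT.limitMean μ γ β)
    (fun n => (hmeas n).aemeasurable) (fun n => (((Finset.measurable_fun_sum _ fun e _ =>
      (GibbsCLT.measurable_siteY β).comp (measurable_pi_apply e)).const_mul _).add_const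
        _).aemeasurable)
    (hmain.neg.mono (.of_forall fun n w => le_of_eq ?_)) ?_
  · congr 1
    rw [GibbsCLT.limitMean]
    ring
  · simp_rw [fun n => GibbsCLT.charFun_map_sum_pi (μ := μ) (ι := (G n).edgeSet)
      (GibbsCLT.measurable_siteY (μ := μ) β).aemeasurable]
    -- The argument is -tp and the exponent |E_n|, so k s² = t² |E_n| p² → 2γt².
    have h := GibbsCLT.tendsto_charFun_pow
      (s := fun n => t * -((m n : ℝ) / Nat.card (G n).edgeSet))
      (k := fun n => Fintype.card (G n).edgeSet) (τ := t ^ 2 * (2 * γ))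
      ((GibbsCLT.memLp_siteY hψ hβ).mono_exponent (by norm_num : (2 : ℝ≥0∞) ≤ 4))
      (GibbsCLT.integral_siteY hμ hψ hβ)
      (by simpa using hp0.neg.const_mul t)
      ((hp2.const_mul (t ^ 2)).congr fun n => by rw [Nat.card_eq_fintype_card]; ring)
    have h2 := h.mul_const (Complex.exp (t * GibbsCLT.limitMean μ γ β * Complex.I))
    convert! h2 using 2
    rw [← Complex.exp_add, GibbsCLT.limitVar, GibbsCLT.integral_siteY_sq hμ hψ hβ]
    congr 1
    push_cast
    ring
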